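/- Let $\mathcal M$ be a smooth (finite-dimensional, Hausdorff, boundaryless) Riemannian manifold. For $q\in\mathcal M$ let $\operatorname{Exp}_q(v)=c_{q,v}(1)$ be the Riemannian exponential map, defined for those $v\in T_q\mathcal M$ whose geodesic $c_{q,v}$ (with $c_{q,v}(0)=q$, $\dot c_{q,v}(0)=v$) exists on $[0,1]$. Let $t_0<t_1$ and let $f:[t_0,t_1]\to\mathcal M$ be differentiable with $$f(t_0)=p,\quad f(t_1)=q,\quad \dot f(t_0)=v_p\in T_p\mathcal M,\quad \dot f(t_1)=v_q\in T_q\mathcal M .$$ Let $D\subseteq T_q\mathcal M$ be an open subset of the domain of $\operatorname{Exp}_q$ on which $\operatorname{Exp}_q$ is injective, with $p\in\operatorname{Exp}_q(D)$, and let $\operatorname{Log}_q=(\operatorname{Exp}_q|_D)^{-1}:\operatorname{Exp}_q(D)\to D$. Assume that $p$ and $q$ are not conjugate along the geodesic $t\mapsto\operatorname{Exp}_q(t\operatorname{Log}_q(p))$, $t\in[0,1]$, i.e. that no Jacobi field along it, other than the zero field, vanishes at both end points. Then $\operatorname{Log}_q$ is differentiable at $p$, and we set $$\Delta_p=\operatorname{Log}_q(p),\qquad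 \hat v_p=d(\operatorname{Log}_q)_p(v_p)\in T_q\mathcal M,\qquad \hat v_q=v_q ,$$ and $$a_0(t)=1-\frac{(t-t_0)^2}{(t_1-t_0)^2}+\frac{2(t-t_0)^2(t-t_1)}{(t_1-t_0)^3},\quad b_0(t)=(t-t_0)-\frac{(t-t_0)^2}{t_1-t_0}+\frac{(t-t_0)^2(t-t_1)}{(t_1-t_0)^2},\quad b_1(t)=\frac{(t-t_0)^2(t-t_1)}{(t_1-t_0)^2}.$$ Assume that $a_0(t)\Delta_p+b_0(t)\hat v_p+b_1(t)\hat v_q$ lies in the domain of $\operatorname{Exp}_q$ for all $t\in[t_0,t_1]$ (which is automatic if $\mathcal M$ is complete). Then $$c:[t_0,t_1]\to\mathcal M,\qquad c(t)=\operatorname{Exp}_q\bigl(a_0(t)\Delta_p+b_0(t)\hat v_p+b_1(t)\hat v_q\bigr)$$ is a curve of class $C^1$ that solves the Hermite interpolation problem: $c(t_0)=p$, $c(t_1)=q$, $\dot c(t_0)=v_p$, $\dot c(t_1)=v_q$. -/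

import Mathlib

open Set Filter Topology Bundle
open scoped Manifold ContDiff Bundle

noncomputable section

namespace RiemannHermite

section Geometry

variable {E : Type*} [NormedAddCommGroup E] [NormedSpace ℝ E] {M : Type*} [TopologicalSpace M]
  [ChartedSpace E M]

/-- The velocity `(γ t, γ'(t)) ∈ TM` of a curve `γ`, differentiated within the time set `s`
(one-sided derivatives at the end points of a closed interval). -/
def velocityWithin (γ : ℝ → M) (s : Set ℝ) (t : ℝ) : TangentBundle 𝓘(ℝ, E) M :=
  ⟨γ t, mfderivWithin 𝓘(ℝ, ℝ) 𝓘(ℝ, E) γ s t (1 : ℝ)⟩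

/-- The velocity vector `γ'(t) ∈ T_{γ t} M` at an interior time `t`. -/
def velocity (γ : ℝ → M) (t : ℝ) : TangentSpace 𝓘(ℝ, E) (γ t) :=
  mfderiv 𝓘(ℝ, ℝ) 𝓘(ℝ, E) γ t (1 : ℝ)

variable [IsManifold 𝓘(ℝ, E) ∞ M] [RiemannianBundle (fun x : M ↦ TangentSpace 𝓘(ℝ, E) x)]

/-- The Riemannian metric in the chart `φ` at `x₀`: for `y` in the chart image, the bilinear form
`(u, w) ↦ ⟪d(φ⁻¹)_y u, d(φ⁻¹)_y w⟫` on `E`. -/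
def metricInChart (x₀ : M) (y : E) : E →L[ℝ] E →L[ℝ] ℝ :=
  (innerSL ℝ (E := TangentSpace 𝓘(ℝ, E) ((chartAt E x₀).symm y))).bilinearComp
    (mfderiv 𝓘(ℝ, E) 𝓘(ℝ, E) (chartAt E x₀).symm y)
    (mfderiv 𝓘(ℝ, E) 𝓘(ℝ, E) (chartAt E x₀).symm y)

/-- The Christoffel symbol of the Levi-Civita connection in the chart at `x₀`: `Γ_y(u, w)` is the
vector with `g_y(Γ_y(u, w), z) = (D_u g(w, z) + D_w g(u, z) - D_z g(u, w)) / 2` for all `z`. -/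
def christoffel (x₀ : M) (y u w : E) : E :=
  (metricInChart x₀ y).inverse
    ((1 / 2 : ℝ) • (fderiv ℝ (metricInChart x₀) y u w + fderiv ℝ (metricInChart x₀) y w u
      - ((fderiv ℝ (metricInChart x₀) y).flip u).flip w))

/-- The covariant derivative `D_t V` at time `t` of a vector field `V` along the curve `γ`,
computed in the chart `φ` at `γ t` as `v'(t) + Γ(x'(t), v(t))`, where `x = φ ∘ γ` and
`v(τ) = dφ (V τ)` are the coordinate expressions of `γ` and `V`. (Mathlib identifies
`T_x M` with `E` through the chart at `x`, so this is an element of `T_{γ t} M`.) -/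
def covDerivAlong (γ : ℝ → M) (V : ∀ t, TangentSpace 𝓘(ℝ, E) (γ t)) (t : ℝ) :
    TangentSpace 𝓘(ℝ, E) (γ t) :=
  let φ : M → E := chartAt E (γ t)
  let v : ℝ → E := fun τ ↦ mfderiv 𝓘(ℝ, E) 𝓘(ℝ, E) φ (γ τ) (V τ)
  (deriv v t + christoffel (γ t) (φ (γ t)) (deriv (φ ∘ γ) t) (v t) : E)

/-- The curvature tensor `R(u, w)z`, with the sign convention
`R(X, Y)Z = ∇_X ∇_Y Z - ∇_Y ∇_X Z - ∇_[X, Y] Z`, computed in the chart at `x`. -/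
def curvature (x : M) (u w z : TangentSpace 𝓘(ℝ, E) x) : TangentSpace 𝓘(ℝ, E) x :=
  let y : E := chartAt E x x
  let Γ : E → E → E → E := christoffel x
  (fderiv ℝ (fun y' ↦ Γ y' w z) y u - fderiv ℝ (fun y' ↦ Γ y' u z) y w
    + Γ y u (Γ y w z) - Γ y w (Γ y u z) : E)

/-- `γ` is a geodesic on the (open) time set `s`: `D_t γ' = 0`. -/
def IsGeodesicOn (γ : ℝ → M) (s : Set ℝ) : Prop :=
  ContMDiffOn 𝓘(ℝ, ℝ) 𝓘(ℝ, E) 2 γ s ∧ ∀ t ∈ s, covDerivAlong (E := E) γ (velocity γ) t = 0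

/-- `J` is a Jacobi field along `γ` on the (open) time set `s`: `D_t D_t J + R(J, γ')γ' = 0`. -/
def IsJacobiFieldOn (γ : ℝ → M) (J : ∀ t, TangentSpace 𝓘(ℝ, E) (γ t)) (s : Set ℝ) : Prop :=
  ContMDiffOn 𝓘(ℝ, ℝ) 𝓘(ℝ, E).tangent 2
      (fun t ↦ (⟨γ t, J t⟩ : TangentBundle 𝓘(ℝ, E) M)) s ∧
    ∀ t ∈ s, covDerivAlong γ (covDerivAlong γ J) t
      + curvature (γ t) (J t) (velocity γ t) (velocity γ t) = 0

variable (E) in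
/-- The end points `γ a`, `γ b` are conjugate along the geodesic `γ`: some Jacobi field along `γ`
vanishes at `a` and at `b` but is not identically zero on `[a, b]`. -/
def AreConjugateAlong (γ : ℝ → M) (a b : ℝ) : Prop :=
  ∃ J : ∀ t, TangentSpace 𝓘(ℝ, E) (γ t), ∃ ε > 0, IsJacobiFieldOn γ J (Ioo (a - ε) (b + ε)) ∧
    J a = 0 ∧ J b = 0 ∧ ∃ t ∈ Icc a b, J t ≠ 0

/-- `γ` is a geodesic, defined on an open interval containing `[0, 1]`, that starts at time `0`
from `q` with velocity `v`. -/
def IsGeodesicFrom (q : M) (v : TangentSpace 𝓘(ℝ, E) q) (γ : ℝ → M) : Prop :=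
  (∃ ε > 0, IsGeodesicOn (E := E) γ (Ioo (0 - ε) (1 + ε))) ∧
    (⟨γ 0, velocity γ 0⟩ : TangentBundle 𝓘(ℝ, E) M) = ⟨q, v⟩

/-- The domain of the Riemannian exponential map `Exp_q`: the vectors `v` whose geodesic exists
up to time `1`. -/
def expDomain (q : M) : Set (TangentSpace 𝓘(ℝ, E) q) :=
  {v | ∃ γ : ℝ → M, IsGeodesicFrom q v γ}

open Classical in
/-- The Riemannian exponential map: `Exp_q v = γ 1` for the geodesic `γ` from `q` with velocity
`v` (with the irrelevant value `q` for `v` outside the domain). -/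
def expMap (q : M) (v : TangentSpace 𝓘(ℝ, E) q) : M :=
  if h : ∃ γ : ℝ → M, IsGeodesicFrom q v γ then h.choose 1 else q

/-- The Riemannian logarithm at `q`: the inverse of the restriction of `Exp_q` to a set
`D ⊆ T_q M` on which `Exp_q` is injective. -/
def logMap (q : M) (D : Set (TangentSpace 𝓘(ℝ, E) q)) : M → TangentSpace 𝓘(ℝ, E) q :=
  Function.invFunOn (expMap q) D

/-- The differential `d(Log_q)_p : T_p M → T_q M`, where the tangent spaces of the vector space
`T_q M` (whose underlying topological vector space is `E`) are identified with `T_q M`. -/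
def dLog (q : M) (D : Set (TangentSpace 𝓘(ℝ, E) q)) (p : M) :
    TangentSpace 𝓘(ℝ, E) p →L[ℝ] TangentSpace 𝓘(ℝ, E) q :=
  mfderiv 𝓘(ℝ, E) 𝓘(ℝ, E) (M' := E) (logMap q D) p

end Geometry

/-- Cubic Hermite polynomial with value `1`, slope `0` at `t₀` and value `0`, slope `0` at `t₁`. -/
def hermiteA0 (t₀ t₁ t : ℝ) : ℝ :=
  1 - 1 / (t₁ - t₀) ^ 2 * (t - t₀) ^ 2 + 2 / (t₁ - t₀) ^ 3 * ((t - t₀) ^ 2 * (t - t₁))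

/-- Cubic Hermite polynomial with value `0`, slope `1` at `t₀` and value `0`, slope `0` at `t₁`. -/
def hermiteB0 (t₀ t₁ t : ℝ) : ℝ :=
  (t - t₀) - 1 / (t₁ - t₀) * (t - t₀) ^ 2 + 1 / (t₁ - t₀) ^ 2 * ((t - t₀) ^ 2 * (t - t₁))

/-- Cubic Hermite polynomial with value `0`, slope `0` at `t₀` and value `0`, slope `1` at `t₁`. -/
def hermiteB1 (t₀ t₁ t : ℝ) : ℝ :=
  1 / (t₁ - t₀) ^ 2 * ((t - t₀) ^ 2 * (t - t₁))

section Interpolant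

variable {E : Type*} [NormedAddCommGroup E] [NormedSpace ℝ E] {M : Type*} [TopologicalSpace M]
  [ChartedSpace E M] [IsManifold 𝓘(ℝ, E) ∞ M]
  [RiemannianBundle (fun x : M ↦ TangentSpace 𝓘(ℝ, E) x)]

/-- The curve `a₀(t) Δ_p + b₀(t) v̂_p + b₁(t) v̂_q` in `T_q M`, with `Δ_p = Log_q p`,
`v̂_p = d(Log_q)_p v_p` and `v̂_q = v_q`; here `Log_q` is the inverse of `Exp_q` on `D`. -/
def tangentInterpolant (t₀ t₁ : ℝ) (p q : M) (D : Set (TangentSpace 𝓘(ℝ, E) q))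
    (v_p : TangentSpace 𝓘(ℝ, E) p) (v_q : TangentSpace 𝓘(ℝ, E) q) (t : ℝ) :
    TangentSpace 𝓘(ℝ, E) q :=
  hermiteA0 t₀ t₁ t • logMap q D p + hermiteB0 t₀ t₁ t • dLog q D p v_p + hermiteB1 t₀ t₁ t • v_q

/-- The interpolating curve `c(t) = Exp_q (a₀(t) Δ_p + b₀(t) v̂_p + b₁(t) v̂_q)`. -/
def hermiteCurve (t₀ t₁ : ℝ) (p q : M) (D : Set (TangentSpace 𝓘(ℝ, E) q))
    (v_p : TangentSpace 𝓘(ℝ, E) p) (v_q : TangentSpace 𝓘(ℝ, E) q) (t : ℝ) : M :=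
  expMap q (tangentInterpolant t₀ t₁ p q D v_p v_q t)

end Interpolant

end RiemannHermite

end

noncomputable section

set_option maxSynthPendingDepth 3
set_option linter.unusedSectionVars false

namespace RiemannHermite

/-! ### Differentiable dependence of ODE solutions on the initial value -/

section LocalFlow

open Metric

variable {V : Type*} [NormedAddCommGroup V] [NormedSpace ℝ V]

/-! The interpolation itself is a chain rule computation; the work lies in the regularity of
`Exp_q`. The cubic P in T_q M has value Δ_p and slope v̂_p at t₀, and value 0 and slope v_q at t₁.
If `Exp_q` is C¹ on its domain, then c = Exp_q ∘ P is C¹. The conditions at t₁ follow from Exp_q(0)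
= q and d(Exp_q)_0 = id (`fderiv_chart_modelExp_zero`), those at t₀ from Exp_q(Δ_p) = p and from
d(Exp_q) at Δ_p being inverse to d(Log_q)_p.

Regularity of `Exp_q`: in a chart, geodesics are integral curves of the spray, whose local flow is
C¹ in the initial state (`exists_local_flow`). The transformation law of the Christoffel symbols
makes the geodesic equation independent of the chart. Local flows are then chained along a whole
geodesic by a connectedness argument in time (`GeodesicFrom.exists_isGeodesicFamily`).

Invertibility at Δ = Δ_p: for w in T_q M, the variation J(t) = d/ds Exp_q(t(Δ + s w)) at s = 0
solves the linearized spray equation, which is the Jacobi equation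
(`jacobi_equation_of_linearized`). It vanishes at t = 0, and at t = 1 it equals d(Exp_q)_Δ w. If w ≠
0 it is non-zero for some small t > 0, because d(Exp_q)_0 = id. So a non-zero kernel vector would
make the end points conjugate (`injective_fderiv_chart_modelExp`). The inverse function theorem now
gives a local inverse of `Exp_q` near p, and injectivity on the open set D identifies it with
`Log_q` (`mdifferentiableAt_modelLog`). -/

/-- A curve that vanishes at time `0` and whose derivative is at most `c + K ‖R‖` is at most
`2 δ c` on `[-δ, δ]`, if `δ K ≤ 1 / 2`. -/
theorem norm_le_of_norm_deriv_le_add_mul_norm {R R' : ℝ → V} {δ K c : ℝ} (hδ : 0 < δ)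
    (hK : δ * K ≤ 1 / 2) (hK0 : 0 ≤ K)
    (hR0 : R 0 = 0) (hR : ∀ t ∈ Icc (-δ) δ, HasDerivWithinAt R (R' t) (Icc (-δ) δ) t)
    (hbd : ∀ t ∈ Icc (-δ) δ, ‖R' t‖ ≤ c + K * ‖R t‖) :
    ∀ t ∈ Icc (-δ) δ, ‖R t‖ ≤ 2 * δ * c := by
  have hcont : ContinuousOn (fun t ↦ ‖R t‖) (Icc (-δ) δ) :=
    (HasDerivWithinAt.continuousOn hR).norm
  have h0 : (0 : ℝ) ∈ Icc (-δ) δ := ⟨by linarith, hδ.le⟩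
  -- At a maximum point of ‖R‖ the mean value inequality gives ‖R tm‖ ≤ δ (c + K ‖R tm‖), and δ K ≤
  -- 1/2 absorbs the last term. This replaces Grönwall's inequality and treats both time directions
  -- at once.
  obtain ⟨tm, htm, hmax⟩ := isCompact_Icc.exists_isMaxOn ⟨0, h0⟩ hcont
  have hmax' : ∀ t ∈ Icc (-δ) δ, ‖R t‖ ≤ ‖R tm‖ := fun t ht ↦ hmax ht
  have h1 := (convex_Icc (-δ) δ).norm_image_sub_le_of_norm_hasDerivWithin_le hR
    (C := c + K * ‖R tm‖) (fun t ht ↦ (hbd t ht).trans (by gcongr; exact hmax' t ht)) h0 htm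
  have h2 : ‖R tm‖ ≤ (c + K * ‖R tm‖) * δ := by
    rw [hR0, sub_zero, sub_zero, Real.norm_eq_abs] at h1
    refine h1.trans ?_
    have : 0 ≤ c + K * ‖R tm‖ := (norm_nonneg _).trans (hbd tm htm)
    gcongr
    exact abs_le.2 htm
  intro t ht
  refine (hmax' t ht).trans ?_
  have h3 : δ * K * ‖R tm‖ ≤ 1 / 2 * ‖R tm‖ := by gcongr
  linarith

/-- Second order Taylor bound for a function whose derivative is Lipschitz on a ball. -/
theorem norm_sub_sub_fderiv_le {F : V → V} {z₀ : V} {ρ : ℝ} {K : NNReal}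
    (hd : ∀ z ∈ ball z₀ ρ, DifferentiableAt ℝ F z)
    (hl : LipschitzOnWith K (fderiv ℝ F) (ball z₀ ρ)) {y y' : V} (hy : y ∈ ball z₀ ρ)
    (hy' : y' ∈ ball z₀ ρ) :
    ‖F y' - F y - fderiv ℝ F y (y' - y)‖ ≤ K * ‖y' - y‖ ^ 2 := by
  have hconv : Convex ℝ (ball z₀ ρ ∩ closedBall y ‖y' - y‖) :=
    (convex_ball _ _).inter (convex_closedBall _ _)
  have := hconv.norm_image_sub_le_of_norm_hasFDerivWithin_le' (f := F) (f' := fderiv ℝ F)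
    (φ := fderiv ℝ F y) (C := K * ‖y' - y‖)
    (fun x hx ↦ (hd x hx.1).hasFDerivAt.hasFDerivWithinAt)
    (fun x hx ↦ by
      refine (hl.norm_sub_le hx.1 hy).trans ?_
      gcongr
      simpa [dist_eq_norm] using hx.2)
    (x := y) (y := y') ⟨hy, by simp⟩ ⟨hy', by simp [dist_eq_norm]⟩
  exact this.trans_eq (by ring)

/-- The local flow of a `C²` vector field exists, stays in a prescribed neighbourhood, and is
continuously differentiable in the initial point, with derivative solving the linearized equation. -/
theorem exists_local_flow [CompleteSpace V] {F : V → V} {z₀ : V} (hF : ContDiffAt ℝ 2 F z₀)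
    {U : Set V} (hU : U ∈ 𝓝 z₀) :
    ∃ δ > 0, ∃ W : Set V, IsOpen W ∧ z₀ ∈ W ∧ ∃ Φ : V → ℝ → V, ∃ A : V → ℝ → V →L[ℝ] V,
      ∀ z ∈ W, Φ z 0 = z ∧ A z 0 = ContinuousLinearMap.id ℝ V ∧ ∀ t ∈ Ioo (-δ) δ,
        Φ z t ∈ U ∧ HasDerivAt (Φ z) (F (Φ z t)) t ∧
        HasDerivAt (A z) ((fderiv ℝ F (Φ z t)).comp (A z t)) t ∧
        HasFDerivAt (fun z ↦ Φ z t) (A z t) z ∧ ContinuousAt (fun z ↦ A z t) z := by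
  have hdF : ContDiffAt ℝ 1 (fderiv ℝ F) z₀ := hF.fderiv_right (by norm_num)
  obtain ⟨K₂, s, hs, hlip⟩ := hdF.exists_lipschitzOnWith
  set K₁ : ℝ := ‖fderiv ℝ F z₀‖ + 1 with hK₁
  have hK₁pos : 0 < K₁ := by positivity
  have hev : ∀ᶠ z in 𝓝 z₀, DifferentiableAt ℝ F z ∧ ‖fderiv ℝ F z‖ < K₁ ∧ z ∈ s ∧ z ∈ U := by
    have e1 : ∀ᶠ z in 𝓝 z₀, ContDiffAt ℝ 2 F z := hF.eventually (by simp)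
    have e2 : ∀ᶠ z in 𝓝 z₀, ‖fderiv ℝ F z‖ < K₁ :=
      hdF.continuousAt.norm.eventually_lt_const (by simp [hK₁])
    filter_upwards [e1, e2, hs, hU] with z h1 h2 h3 h4
    exact ⟨h1.differentiableAt (by norm_num), h2, h3, h4⟩
  obtain ⟨ρ, hρ, hball⟩ := Metric.eventually_nhds_iff_ball.1 hev
  have hlip' : LipschitzOnWith K₂ (fderiv ℝ F) (ball z₀ ρ) := hlip.mono fun z hz ↦ (hball z hz).2.2.1
  -- the vector field of the system formed by the equation and its linearization
  let G : V × (V →L[ℝ] V) → V × (V →L[ℝ] V) := fun y ↦ (F y.1, (fderiv ℝ F y.1).comp y.2)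
  set y₀ : V × (V →L[ℝ] V) := (z₀, ContinuousLinearMap.id ℝ V) with hy₀
  have hG : ContDiffAt ℝ 1 G y₀ := by
    refine ContDiffAt.prodMk ?_ ?_
    · exact ContDiffAt.comp (g := F) y₀ (hF.of_le (by norm_num)) contDiffAt_fst
    · exact ContDiffAt.clm_comp (ContDiffAt.comp (g := fderiv ℝ F) y₀ hdF contDiffAt_fst)
        contDiffAt_snd
  -- Since F is C², the augmented field G is C¹, so Picard–Lindelöf provides solutions that are
  -- Lipschitz in the initial value. Started at (z, id), the second component is the candidate for
  -- the derivative of the flow.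
  obtain ⟨ε, hε, a, r, L, K, hr, hpl⟩ := IsPicardLindelof.of_contDiffAt_one hG
  obtain ⟨α, hα, L', hL'⟩ :=
    (hpl 0).exists_forall_mem_closedBall_eq_hasDerivWithinAt_lipschitzOnWith
  simp only [zero_sub, zero_add] at hα hL'
  have hr0 : (0 : ℝ) < r := hr
  have hc0 : ContinuousAt (α y₀) 0 :=
    (((hα y₀ (mem_closedBall_self hr0.le)).2 0 ⟨by linarith, hε.le⟩).hasDerivAt
      (Icc_mem_nhds (by linarith) hε)).continuousAt
  have hy00 : α y₀ 0 = y₀ := (hα y₀ (mem_closedBall_self hr0.le)).1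
  obtain ⟨η, hη, hηb⟩ := Metric.continuousAt_iff.1 hc0 (ρ / 2) (by positivity)
  -- `η` keeps the solution through `y₀` within ρ/2 of `y₀`, `ε` is the existence time, and 1/(2 K₁)
  -- is what the absorption estimate requires.
  set δ : ℝ := min (η / 2) (min ε (1 / (2 * K₁))) with hδdef
  have hδ : 0 < δ := by positivity
  have hδη : δ < η := (min_le_left _ _).trans_lt (by linarith)
  have hδε : δ ≤ ε := (min_le_right _ _).trans (min_le_left _ _)
  have hδK : δ * K₁ ≤ 1 / 2 := by
    have : δ ≤ 1 / (2 * K₁) := (min_le_right _ _).trans (min_le_right _ _)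
    calc δ * K₁ ≤ 1 / (2 * K₁) * K₁ := by gcongr
      _ = 1 / 2 := by field_simp
  -- Initial values within `r'` move a solution by at most L' r' ≤ ρ/2; with the ρ/2 coming from
  -- `η`, all these solutions stay in the ball of radius ρ. The `+ 1` guards against L' = 0.
  set r' : ℝ := min r (ρ / (2 * (L' + 1))) with hr'def
  have hr' : 0 < r' := by positivity
  let Y : V → V × (V →L[ℝ] V) := fun z ↦ (z, ContinuousLinearMap.id ℝ V)
  have hYdist : ∀ z z', dist (Y z) (Y z') = dist z z' := fun z z' ↦ by
    simp [Y, Prod.dist_eq]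
  have hYmem : ∀ z ∈ ball z₀ r', Y z ∈ closedBall y₀ r := fun z hz ↦ by
    rw [mem_closedBall, hy₀, hYdist z z₀]
    exact (mem_ball.1 hz).le.trans (min_le_left _ _)
  have hsub : Icc (-δ) δ ⊆ Icc (-ε) ε := Icc_subset_Icc (by linarith) hδε
  have hstay : ∀ z ∈ ball z₀ r', ∀ t ∈ Icc (-δ) δ, (α (Y z) t).1 ∈ ball z₀ ρ := by
    intro z hz t ht
    have h1 : dist (α (Y z) t) (α y₀ t) ≤ L' * dist z z₀ := by
      rw [← hYdist z z₀]
      exact (hL' t (hsub ht)).dist_le_mul _ (hYmem z hz) _ (mem_closedBall_self hr0.le)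
    have h2 : dist (α y₀ t) y₀ < ρ / 2 := by
      have := hηb (x := t) (by simpa using (abs_le.2 ht).trans_lt hδη)
      rwa [hy00] at this
    have h3 : (L' : ℝ) * dist z z₀ ≤ ρ / 2 := by
      have : dist z z₀ ≤ ρ / (2 * (L' + 1)) := (mem_ball.1 hz).le.trans (min_le_right _ _)
      calc (L' : ℝ) * dist z z₀ ≤ (L' + 1) * (ρ / (2 * (L' + 1))) := by gcongr; linarith
        _ = ρ / 2 := by field_simp
    have h4 : dist (α (Y z) t).1 z₀ ≤ dist (α (Y z) t) y₀ := by
      rw [Prod.dist_eq]; exact le_max_left _ _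
    rw [mem_ball]
    linarith [dist_triangle (α (Y z) t) (α y₀ t) y₀]
  have hderiv : ∀ z ∈ ball z₀ r', ∀ t ∈ Icc (-δ) δ,
      HasDerivWithinAt (fun t ↦ (α (Y z) t).1) (F (α (Y z) t).1) (Icc (-δ) δ) t ∧
      HasDerivWithinAt (fun t ↦ (α (Y z) t).2)
        ((fderiv ℝ F (α (Y z) t).1).comp (α (Y z) t).2) (Icc (-δ) δ) t := by
    intro z hz t ht
    have h := ((hα (Y z) (hYmem z hz)).2 t (hsub ht)).mono hsub
    exact ⟨h.fst, h.snd⟩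
  -- The error R of the linear approximation starts at 0, and R' is DF applied to R plus the Taylor
  -- remainder of F, which is quadratic in z' - z. Hence R is quadratic in z' - z as well.
  have hest : ∀ z ∈ ball z₀ r', ∀ z' ∈ ball z₀ r', ∀ t ∈ Icc (-δ) δ,
      ‖(α (Y z') t).1 - (α (Y z) t).1 - (α (Y z) t).2 (z' - z)‖
        ≤ 2 * δ * (K₂ * (L' * ‖z' - z‖) ^ 2) := by
    intro z hz z' hz'
    refine norm_le_of_norm_deriv_le_add_mul_norm
      (R' := fun t ↦ F (α (Y z') t).1 - F (α (Y z) t).1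
        - ((fderiv ℝ F (α (Y z) t).1).comp (α (Y z) t).2) (z' - z)) hδ hδK hK₁pos.le ?_ ?_ ?_
    · simp [(hα (Y z) (hYmem z hz)).1, (hα (Y z') (hYmem z' hz')).1, Y]
    · intro t ht
      exact ((hderiv z' hz' t ht).1.sub (hderiv z hz t ht).1).sub
        ((hderiv z hz t ht).2.clm_apply (hasDerivWithinAt_const t _ (z' - z)) |>.congr_deriv
          (by simp))
    · intro t ht
      have hT := norm_sub_sub_fderiv_le (fun z hz ↦ (hball z hz).1) hlip' (hstay z hz t ht)
        (hstay z' hz' t ht)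
      have hLL : ‖(α (Y z') t).1 - (α (Y z) t).1‖ ≤ L' * ‖z' - z‖ := by
        have := (hL' t (hsub ht)).dist_le_mul _ (hYmem z' hz') _ (hYmem z hz)
        rw [hYdist, dist_eq_norm z'] at this
        rw [← dist_eq_norm]
        refine le_trans ?_ this
        rw [Prod.dist_eq]; exact le_max_left _ _
      have hdecomp : F (α (Y z') t).1 - F (α (Y z) t).1
          - ((fderiv ℝ F (α (Y z) t).1).comp (α (Y z) t).2) (z' - z)
          = (F (α (Y z') t).1 - F (α (Y z) t).1
            - fderiv ℝ F (α (Y z) t).1 ((α (Y z') t).1 - (α (Y z) t).1))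
            + fderiv ℝ F (α (Y z) t).1
              ((α (Y z') t).1 - (α (Y z) t).1 - (α (Y z) t).2 (z' - z)) := by
        simp only [ContinuousLinearMap.comp_apply, map_sub]
        abel
      rw [hdecomp]
      refine (norm_add_le _ _).trans (add_le_add (hT.trans ?_) ?_)
      · gcongr
      · exact (ContinuousLinearMap.le_opNorm _ _).trans
          (by gcongr; exact (hball _ (hstay z hz t ht)).2.1.le)
  refine ⟨δ, hδ, ball z₀ r', isOpen_ball, mem_ball_self hr', fun z t ↦ (α (Y z) t).1,
    fun z t ↦ (α (Y z) t).2, fun z hz ↦ ⟨?_, ?_, fun t ht ↦ ?_⟩⟩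
  · simp [(hα (Y z) (hYmem z hz)).1, Y]
  · simp [(hα (Y z) (hYmem z hz)).1, Y]
  have ht' := Ioo_subset_Icc_self ht
  refine ⟨(hball _ (hstay z hz t ht')).2.2.2,
    (hderiv z hz t ht').1.hasDerivAt (Icc_mem_nhds ht.1 ht.2),
    (hderiv z hz t ht').2.hasDerivAt (Icc_mem_nhds ht.1 ht.2), ?_, ?_⟩
  · rw [hasFDerivAt_iff_isLittleO]
    have hO : (fun z' ↦ (α (Y z') t).1 - (α (Y z) t).1 - (α (Y z) t).2 (z' - z))
        =O[𝓝 z] fun z' ↦ ‖z' - z‖ ^ 2 := by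
      refine Asymptotics.IsBigO.of_bound (2 * δ * (K₂ * (L' : ℝ) ^ 2)) ?_
      filter_upwards [isOpen_ball.mem_nhds hz] with z' hz'
      refine (hest z hz z' hz' t ht').trans_eq ?_
      rw [norm_pow, norm_norm]
      ring
    refine hO.trans_isLittleO ?_
    exact Asymptotics.isLittleO_pow_sub_sub z (by norm_num : 1 < 2)
  -- The derivative is itself a component of the Lipschitz flow of the augmented system, hence
  -- continuous in z.
  · have hYc : ContinuousAt (fun z' ↦ α (Y z') t) z := by
      have hc : ContinuousOn (fun z' ↦ α (Y z') t) (ball z₀ r') :=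
        (hL' t (hsub ht')).continuousOn.comp (by fun_prop) hYmem
      exact hc.continuousAt (isOpen_ball.mem_nhds hz)
    exact hYc.snd

end LocalFlow

/-! ### Christoffel symbols of a metric on a vector space -/

section CoordinateChristoffel

variable {E : Type*} [NormedAddCommGroup E] [NormedSpace ℝ E]

/-- The trilinear form `(u, w, z) ↦ (D u w z + D w u z - D z u w) / 2` of the Koszul formula. -/
def koszulForm (D : E →L[ℝ] E →L[ℝ] E →L[ℝ] ℝ) : E →L[ℝ] E →L[ℝ] E →L[ℝ] ℝ :=
  (1 / 2 : ℝ) • (D + D.flip -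
    ((ContinuousLinearMap.flipₗᵢ ℝ E E ℝ).toContinuousLinearEquiv :
      (E →L[ℝ] E →L[ℝ] ℝ) →L[ℝ] (E →L[ℝ] E →L[ℝ] ℝ)).comp D.flip)

theorem koszulForm_apply_apply (D : E →L[ℝ] E →L[ℝ] E →L[ℝ] ℝ) (u w z : E) :
    koszulForm D u w z = 1 / 2 * (D u w z + D w u z - D z u w) := rfl

/-- The Christoffel symbol of a field of bilinear forms, as a continuous bilinear map. -/
def christoffelForm (g : E → E →L[ℝ] E →L[ℝ] ℝ) (y : E) : E →L[ℝ] E →L[ℝ] E :=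
  (ContinuousLinearMap.compL ℝ E (E →L[ℝ] ℝ) E (g y).inverse).comp (koszulForm (fderiv ℝ g y))

theorem christoffelForm_apply (g : E → E →L[ℝ] E →L[ℝ] ℝ) (y u w : E) :
    christoffelForm g y u w = (g y).inverse (koszulForm (fderiv ℝ g y) u w) := rfl

theorem apply_christoffelForm {g : E → E →L[ℝ] E →L[ℝ] ℝ} {y : E} (h : (g y).IsInvertible)
    (u w z : E) : g y (christoffelForm g y u w) z =
      1 / 2 * (fderiv ℝ g y u w z + fderiv ℝ g y w u z - fderiv ℝ g y z u w) := by
  rw [christoffelForm_apply, h.self_apply_inverse, koszulForm_apply_apply]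

set_option synthInstance.maxHeartbeats 200000 in
theorem contDiff_koszulForm {n : ℕ∞ω} : ContDiff ℝ n (koszulForm (E := E)) := by
  have hflip : ContDiff ℝ n fun D : E →L[ℝ] E →L[ℝ] E →L[ℝ] ℝ ↦ D.flip :=
    (ContinuousLinearMap.flipₗᵢ ℝ E E (E →L[ℝ] ℝ)).contDiff
  unfold koszulForm
  exact ((contDiff_id.add hflip).sub (contDiff_const.clm_comp hflip)).const_smul _

/-- Inversion of continuous linear maps is smooth at invertible ones, and the Koszul form depends
linearly on the derivative of the metric. -/
theorem contDiffAt_christoffelForm [CompleteSpace E] {g : E → E →L[ℝ] E →L[ℝ] ℝ} {y : E}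
    (hg : ContDiffAt ℝ ∞ g y) (h : (g y).IsInvertible) : ContDiffAt ℝ ∞ (christoffelForm g) y := by
  have h1 : ContDiffAt ℝ ∞ (fun y ↦ (g y).inverse) y :=
    (ContinuousLinearMap.IsInvertible.contDiffAt_map_inverse h).comp y hg
  have h2 : ContDiffAt ℝ ∞ (fun y ↦ koszulForm (fderiv ℝ g y)) y :=
    contDiff_koszulForm.contDiffAt.comp y (hg.fderiv_right (by simp))
  exact ContDiffAt.clm_comp
    ((ContinuousLinearMap.compL ℝ E (E →L[ℝ] ℝ) E).contDiff.contDiffAt.comp y h1) h2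

/-- Directional derivatives of a field of symmetric forms are symmetric. -/
theorem fderiv_symm_of_eventually {g : E → E →L[ℝ] E →L[ℝ] ℝ} {y : E}
    (hg : DifferentiableAt ℝ g y) (hs : ∀ᶠ y' in 𝓝 y, ∀ u w, g y' u w = g y' w u) (z u w : E) :
    fderiv ℝ g y z u w = fderiv ℝ g y z w u := by
  have h : ∀ u w, HasFDerivAt (fun y' ↦ g y' u w)
      (((ContinuousLinearMap.apply ℝ ℝ w).comp (ContinuousLinearMap.apply ℝ (E →L[ℝ] ℝ) u)).comp
        (fderiv ℝ g y)) y := fun u w ↦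
    (((ContinuousLinearMap.apply ℝ ℝ w).comp
      (ContinuousLinearMap.apply ℝ (E →L[ℝ] ℝ) u)).hasFDerivAt).comp y hg.hasFDerivAt
  have he : (fun y' ↦ g y' u w) =ᶠ[𝓝 y] fun y' ↦ g y' w u := hs.mono fun y' h ↦ h u w
  have := ((h u w).congr_of_eventuallyEq he.symm).unique (h w u)
  exact DFunLike.congr_fun this z

theorem christoffelForm_symm {g : E → E →L[ℝ] E →L[ℝ] ℝ} {y : E}
    (hg : DifferentiableAt ℝ g y) (hs : ∀ᶠ y' in 𝓝 y, ∀ u w, g y' u w = g y' w u) (u w : E) :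
    christoffelForm g y u w = christoffelForm g y w u := by
  rw [christoffelForm_apply, christoffelForm_apply]
  congr 1
  ext z
  rw [koszulForm_apply_apply, koszulForm_apply_apply, fderiv_symm_of_eventually hg hs z u w]
  ring

/-- The derivative of the pull-back of a field of bilinear forms. -/
theorem fderiv_pullback_form {g₀ g₁ : E → E →L[ℝ] E →L[ℝ] ℝ} {ψ : E → E} {y : E}
    (hψ : ContDiffAt ℝ 2 ψ y) (hg₀ : DifferentiableAt ℝ g₀ y) (hg₁ : DifferentiableAt ℝ g₁ (ψ y))
    (hpull : ∀ᶠ y' in 𝓝 y, ∀ u w, g₀ y' u w = g₁ (ψ y') (fderiv ℝ ψ y' u) (fderiv ℝ ψ y' w))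
    (z u w : E) :
    fderiv ℝ g₀ y z u w =
      fderiv ℝ g₁ (ψ y) (fderiv ℝ ψ y z) (fderiv ℝ ψ y u) (fderiv ℝ ψ y w)
      + g₁ (ψ y) (fderiv ℝ (fderiv ℝ ψ) y z u) (fderiv ℝ ψ y w)
      + g₁ (ψ y) (fderiv ℝ ψ y u) (fderiv ℝ (fderiv ℝ ψ) y z w) := by
  have h0 : HasFDerivAt (fun y' ↦ g₀ y' u w)
      (((ContinuousLinearMap.apply ℝ ℝ w).comp (ContinuousLinearMap.apply ℝ (E →L[ℝ] ℝ) u)).comp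
        (fderiv ℝ g₀ y)) y :=
    (((ContinuousLinearMap.apply ℝ ℝ w).comp
      (ContinuousLinearMap.apply ℝ (E →L[ℝ] ℝ) u)).hasFDerivAt).comp y hg₀.hasFDerivAt
  have hψd : HasFDerivAt ψ (fderiv ℝ ψ y) y := (hψ.differentiableAt (by norm_num)).hasFDerivAt
  have hdψ : HasFDerivAt (fderiv ℝ ψ) (fderiv ℝ (fderiv ℝ ψ) y) y :=
    ((hψ.fderiv_right (m := 1) (by norm_num)).differentiableAt (by norm_num)).hasFDerivAt
  have hdu : ∀ u, HasFDerivAt (fun y' ↦ fderiv ℝ ψ y' u)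
      ((ContinuousLinearMap.apply ℝ E u).comp (fderiv ℝ (fderiv ℝ ψ) y)) y := fun u ↦
    ((ContinuousLinearMap.apply ℝ E u).hasFDerivAt).comp y hdψ
  have h1 := ((hg₁.hasFDerivAt.comp y hψd).clm_apply (hdu u)).clm_apply (hdu w)
  have he : (fun y' ↦ g₀ y' u w) =ᶠ[𝓝 y]
      fun y' ↦ g₁ (ψ y') (fderiv ℝ ψ y' u) (fderiv ℝ ψ y' w) := hpull.mono fun y' h ↦ h u w
  have := DFunLike.congr_fun (h0.unique (h1.congr_of_eventuallyEq he)) z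
  simp only [ContinuousLinearMap.comp_apply, ContinuousLinearMap.apply_apply, Function.comp_apply,
    add_apply, ContinuousLinearMap.flip_apply] at this
  rw [this]
  ring

/-- The transformation law of Christoffel symbols under a change of coordinates. -/
theorem fderiv_christoffelForm_eq_add {g₀ g₁ : E → E →L[ℝ] E →L[ℝ] ℝ} {ψ : E → E} {y : E}
    (hψ : ContDiffAt ℝ 2 ψ y) (hsurj : Function.Surjective (fderiv ℝ ψ y))
    (hg₀ : DifferentiableAt ℝ g₀ y) (hg₁ : DifferentiableAt ℝ g₁ (ψ y))
    (hi₀ : (g₀ y).IsInvertible) (hi₁ : (g₁ (ψ y)).IsInvertible)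
    (hs : ∀ u w, g₁ (ψ y) u w = g₁ (ψ y) w u)
    (hpull : ∀ᶠ y' in 𝓝 y, ∀ u w, g₀ y' u w = g₁ (ψ y') (fderiv ℝ ψ y' u) (fderiv ℝ ψ y' w))
    (u w : E) :
    fderiv ℝ ψ y (christoffelForm g₀ y u w) =
      christoffelForm g₁ (ψ y) (fderiv ℝ ψ y u) (fderiv ℝ ψ y w)
        + fderiv ℝ (fderiv ℝ ψ) y u w := by
  have hsymm : ∀ a b, fderiv ℝ (fderiv ℝ ψ) y a b = fderiv ℝ (fderiv ℝ ψ) y b a :=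
    (hψ.isSymmSndFDerivAt (by simp)).eq
  -- By nondegeneracy of g₁ and surjectivity of Dψ it suffices to pair both sides with vectors Dψ z.
  -- In the Koszul combination of the pulled-back metric the second derivatives of ψ then cancel,
  -- except for g₁(D²ψ(u, w), Dψ z).
  apply hi₁.injective
  ext z'
  obtain ⟨z, rfl⟩ := hsurj z'
  rw [← hpull.self_of_nhds, apply_christoffelForm hi₀, map_add, add_apply,
    apply_christoffelForm hi₁, fderiv_pullback_form hψ hg₀ hg₁ hpull,
    fderiv_pullback_form hψ hg₀ hg₁ hpull, fderiv_pullback_form hψ hg₀ hg₁ hpull,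
    hsymm w u, hsymm z u, hsymm z w, hs (fderiv ℝ ψ y w) (fderiv ℝ (fderiv ℝ ψ) y u z)]
  ring

end CoordinateChristoffel

/-! ### Charts, their differentials, and the metric in coordinates -/

section Charts

variable {E : Type*} [NormedAddCommGroup E] [NormedSpace ℝ E] {M : Type*} [TopologicalSpace M]
  [ChartedSpace E M]

/-- The differential `T_m M → E` of the chart at `x₀`. -/
def chartDeriv (x₀ m : M) : E →L[ℝ] E :=
  mfderiv 𝓘(ℝ, E) 𝓘(ℝ, E) (chartAt E x₀) m

/-- The differential `E → T_m M` of the inverse of the chart at `x₀`. -/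
def chartSymmDeriv (x₀ : M) (y : E) : E →L[ℝ] E :=
  mfderiv 𝓘(ℝ, E) 𝓘(ℝ, E) (chartAt E x₀).symm y

/-- The change of coordinates from the chart at `x₀` to the chart at `x₁`. -/
def transition (x₀ x₁ : M) : E → E := chartAt E x₁ ∘ (chartAt E x₀).symm

variable [IsManifold 𝓘(ℝ, E) ∞ M]

theorem mdifferentiableAt_chart {x₀ m : M} (hm : m ∈ (chartAt E x₀).source) :
    MDifferentiableAt 𝓘(ℝ, E) 𝓘(ℝ, E) (chartAt E x₀) m :=
  have : IsManifold 𝓘(ℝ, E) 1 M := .of_le (n := ∞) (by simp)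
  mdifferentiableAt_atlas (chart_mem_atlas E x₀) hm

theorem mdifferentiableAt_chart_symm {x₀ : M} {y : E} (hy : y ∈ (chartAt E x₀).target) :
    MDifferentiableAt 𝓘(ℝ, E) 𝓘(ℝ, E) (chartAt E x₀).symm y :=
  have : IsManifold 𝓘(ℝ, E) 1 M := .of_le (n := ∞) (by simp)
  mdifferentiableAt_atlas_symm (chart_mem_atlas E x₀) hy

theorem contMDiffAt_chart {x₀ m : M} (hm : m ∈ (chartAt E x₀).source) :
    ContMDiffAt 𝓘(ℝ, E) 𝓘(ℝ, E) ∞ (chartAt E x₀) m :=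
  contMDiffOn_chart.contMDiffAt ((chartAt E x₀).open_source.mem_nhds hm)

theorem contMDiffAt_chart_symm {x₀ : M} {y : E} (hy : y ∈ (chartAt E x₀).target) :
    ContMDiffAt 𝓘(ℝ, E) 𝓘(ℝ, E) ∞ (chartAt E x₀).symm y :=
  contMDiffOn_chart_symm.contMDiffAt ((chartAt E x₀).open_target.mem_nhds hy)

theorem transition_chart {x₀ x₁ m : M} (h₀ : m ∈ (chartAt E x₀).source) :
    transition x₀ x₁ (chartAt E x₀ m) = chartAt E x₁ m := by
  simp [transition, (chartAt E x₀).left_inv h₀]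

theorem contDiffAt_transition {x₀ x₁ m : M} (h₀ : m ∈ (chartAt E x₀).source)
    (h₁ : m ∈ (chartAt E x₁).source) :
    ContDiffAt ℝ ∞ (transition x₀ x₁ : E → E) (chartAt E x₀ m) := by
  rw [← contMDiffAt_iff_contDiffAt]
  refine ContMDiffAt.comp _ ?_ (contMDiffAt_chart_symm ((chartAt E x₀).map_source h₀))
  rw [(chartAt E x₀).left_inv h₀]
  exact contMDiffAt_chart h₁

/-- The model E of T_x M is attached through the chart at x, so this chart has identity differential
at x. Hence coordinate identities in the chart at a point can be read as identities in the tangent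
space there. -/
theorem chartDeriv_self (x : M) : chartDeriv x x = ContinuousLinearMap.id ℝ E := by
  have : IsManifold 𝓘(ℝ, E) 1 M := .of_le (n := ∞) (by simp)
  ext v
  rw [chartDeriv, mfderiv_chartAt_eq_tangentCoordChange (mem_chart_source E x)]
  exact tangentCoordChange_self (mem_extChartAt_source x)

theorem chartDeriv_chartSymmDeriv {x₀ m : M} (hm : m ∈ (chartAt E x₀).source) :
    (chartDeriv x₀ m).comp (chartSymmDeriv x₀ (chartAt E x₀ m)) = ContinuousLinearMap.id ℝ E := by
  have hy := (chartAt E x₀).map_source hm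
  have h := mfderiv_comp (I := 𝓘(ℝ, E)) (I' := 𝓘(ℝ, E)) (I'' := 𝓘(ℝ, E)) (chartAt E x₀ m)
    (g := chartAt E x₀) (f := (chartAt E x₀).symm)
    (by rw [(chartAt E x₀).left_inv hm]; exact mdifferentiableAt_chart hm)
    (mdifferentiableAt_chart_symm hy)
  have he : (chartAt E x₀ ∘ (chartAt E x₀).symm : E → E) =ᶠ[𝓝 (chartAt E x₀ m)] id := by
    filter_upwards [(chartAt E x₀).open_target.mem_nhds hy] with y hy
    exact (chartAt E x₀).right_inv hy
  rw [he.mfderiv_eq, mfderiv_id, (chartAt E x₀).left_inv hm] at h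
  exact h.symm

theorem chartSymmDeriv_chartDeriv {x₀ m : M} (hm : m ∈ (chartAt E x₀).source) :
    (chartSymmDeriv x₀ (chartAt E x₀ m)).comp (chartDeriv x₀ m) = ContinuousLinearMap.id ℝ E := by
  have hy := (chartAt E x₀).map_source hm
  have h := mfderiv_comp (I := 𝓘(ℝ, E)) (I' := 𝓘(ℝ, E)) (I'' := 𝓘(ℝ, E)) m
    (f := chartAt E x₀) (g := (chartAt E x₀).symm)
    (mdifferentiableAt_chart_symm hy) (mdifferentiableAt_chart hm)
  have he : ((chartAt E x₀).symm ∘ chartAt E x₀ : M → M) =ᶠ[𝓝 m] id := by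
    filter_upwards [(chartAt E x₀).open_source.mem_nhds hm] with y hy
    exact (chartAt E x₀).left_inv hy
  rw [he.mfderiv_eq, mfderiv_id] at h
  exact h.symm

theorem fderiv_transition {x₀ x₁ m : M} (h₀ : m ∈ (chartAt E x₀).source)
    (h₁ : m ∈ (chartAt E x₁).source) :
    fderiv ℝ (transition x₀ x₁ : E → E) (chartAt E x₀ m) =
      (chartDeriv x₁ m).comp (chartSymmDeriv x₀ (chartAt E x₀ m)) := by
  have hy := (chartAt E x₀).map_source h₀
  have h := mfderiv_comp (I := 𝓘(ℝ, E)) (I' := 𝓘(ℝ, E)) (I'' := 𝓘(ℝ, E)) (chartAt E x₀ m)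
    (g := chartAt E x₁) (f := (chartAt E x₀).symm)
    (by rw [(chartAt E x₀).left_inv h₀]; exact mdifferentiableAt_chart h₁)
    (mdifferentiableAt_chart_symm hy)
  rw [(chartAt E x₀).left_inv h₀] at h
  rw [← mfderiv_eq_fderiv]
  exact h

theorem fderiv_transition_comp_chartDeriv {x₀ x₁ m : M} (h₀ : m ∈ (chartAt E x₀).source)
    (h₁ : m ∈ (chartAt E x₁).source) :
    (fderiv ℝ (transition x₀ x₁ : E → E) (chartAt E x₀ m)).comp (chartDeriv x₀ m)
      = chartDeriv x₁ m := by
  rw [fderiv_transition h₀ h₁, ContinuousLinearMap.comp_assoc, chartSymmDeriv_chartDeriv h₀,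
    ContinuousLinearMap.comp_id]

theorem chartDeriv_isInvertible {x₀ m : M} (hm : m ∈ (chartAt E x₀).source) :
    (chartDeriv x₀ m : E →L[ℝ] E).IsInvertible :=
  .of_inverse (chartDeriv_chartSymmDeriv hm) (chartSymmDeriv_chartDeriv hm)

theorem chartSymmDeriv_isInvertible {x₀ m : M} (hm : m ∈ (chartAt E x₀).source) :
    (chartSymmDeriv x₀ (chartAt E x₀ m) : E →L[ℝ] E).IsInvertible :=
  .of_inverse (chartSymmDeriv_chartDeriv hm) (chartDeriv_chartSymmDeriv hm)

variable [RiemannianBundle (fun x : M ↦ TangentSpace 𝓘(ℝ, E) x)]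

/-- The inner product of `T_m M`, seen on the model space `E`. -/
def innerAt (m : M) (u w : E) : ℝ :=
  innerSL ℝ (E := TangentSpace 𝓘(ℝ, E) m) u w

theorem metricInChart_apply (x₀ : M) (y u w : E) :
    metricInChart x₀ y u w =
      innerAt ((chartAt E x₀).symm y) (chartSymmDeriv x₀ y u) (chartSymmDeriv x₀ y w) := rfl

theorem metricInChart_chart_apply {x₀ m : M} (hm : m ∈ (chartAt E x₀).source) (u w : E) :
    metricInChart x₀ (chartAt E x₀ m) u w =
      innerAt m (chartSymmDeriv x₀ (chartAt E x₀ m) u) (chartSymmDeriv x₀ (chartAt E x₀ m) w) := by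
  rw [metricInChart_apply, (chartAt E x₀).left_inv hm]

theorem innerAt_symm (m : M) (u w : E) : innerAt m u w = innerAt m w u :=
  real_inner_comm (F := TangentSpace 𝓘(ℝ, E) m) w u

theorem innerAt_self_eq_zero {m : M} {u : E} : innerAt m u u = 0 ↔ u = 0 :=
  inner_self_eq_zero (𝕜 := ℝ) (E := TangentSpace 𝓘(ℝ, E) m)

theorem metricInChart_symm (x₀ : M) (y u w : E) :
    metricInChart x₀ y u w = metricInChart x₀ y w u := innerAt_symm _ _ _

/-- Positive definiteness makes the kernel trivial, and E has the same dimension as its dual.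
Without this, `inverse` in `christoffel` could be the default value 0. -/
theorem metricInChart_isInvertible [FiniteDimensional ℝ E] {x₀ : M} {y : E}
    (hy : y ∈ (chartAt E x₀).target) : (metricInChart x₀ y).IsInvertible := by
  have hm := (chartAt E x₀).map_target hy
  have hinj : Function.Injective (metricInChart x₀ y) := by
    rw [injective_iff_map_eq_zero]
    intro u hu
    have h : metricInChart x₀ y u u = 0 := by rw [hu]; rfl
    rw [metricInChart_apply, innerAt_self_eq_zero] at h
    have hi := (chartSymmDeriv_isInvertible hm).injective
    rw [(chartAt E x₀).right_inv hy] at hi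
    exact hi (h.trans (map_zero _).symm)
  have hdim : Module.finrank ℝ E = Module.finrank ℝ (E →L[ℝ] ℝ) := by
    rw [(LinearMap.toContinuousLinearMap (𝕜 := ℝ) (E := E) (F' := ℝ)).symm.finrank_eq]
    exact (Subspace.dual_finrank_eq (K := ℝ) (V := E)).symm
  exact ⟨(LinearEquiv.ofInjectiveOfFinrankEq _ hinj hdim).toContinuousLinearEquiv,
    by ext; rfl⟩

/-- The metrics in two charts are related by the change of coordinates. -/
theorem metricInChart_transition {x₀ x₁ m : M} (h₀ : m ∈ (chartAt E x₀).source)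
    (h₁ : m ∈ (chartAt E x₁).source) (u w : E) :
    metricInChart x₀ (chartAt E x₀ m) u w =
      metricInChart x₁ (transition x₀ x₁ (chartAt E x₀ m))
        (fderiv ℝ (transition x₀ x₁) (chartAt E x₀ m) u)
        (fderiv ℝ (transition x₀ x₁) (chartAt E x₀ m) w) := by
  have hc : ∀ u, chartSymmDeriv x₁ (chartAt E x₁ m)
      (((chartDeriv x₁ m).comp (chartSymmDeriv x₀ (chartAt E x₀ m))) u)
      = chartSymmDeriv x₀ (chartAt E x₀ m) u := fun u ↦
    DFunLike.congr_fun (chartSymmDeriv_chartDeriv h₁) _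
  rw [transition_chart h₀, fderiv_transition h₀ h₁, metricInChart_chart_apply h₀,
    metricInChart_chart_apply h₁, hc, hc]

variable [IsContMDiffRiemannianBundle 𝓘(ℝ, E) ∞ E (fun x : M ↦ TangentSpace 𝓘(ℝ, E) x)]

/-- In finite dimension, smoothness of a form-valued map can be tested on fixed vectors u, w. The
fields y ↦ d(φ⁻¹)_y u are smooth sections along φ⁻¹, and the bundle metric is smooth. -/
theorem contDiffOn_metricInChart [FiniteDimensional ℝ E] (x₀ : M) :
    ContDiffOn ℝ ∞ (metricInChart (E := E) x₀) (chartAt E x₀).target := by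
  have : IsManifold 𝓘(ℝ, E) 1 M := .of_le (n := ∞) (by simp)
  rw [contDiffOn_clm_apply]
  intro u
  rw [contDiffOn_clm_apply]
  intro w
  rw [← contMDiffOn_iff_contDiffOn]
  have hsec : ∀ u : E, ContMDiffOn 𝓘(ℝ, E) 𝓘(ℝ, E).tangent ∞
      (fun y ↦ (⟨(chartAt E x₀).symm y, mfderiv 𝓘(ℝ, E) 𝓘(ℝ, E) (chartAt E x₀).symm y u⟩ :
        TangentBundle 𝓘(ℝ, E) M)) (chartAt E x₀).target := by
    intro u
    have h1 : ContMDiffOn 𝓘(ℝ, E).tangent 𝓘(ℝ, E).tangent ∞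
        (tangentMapWithin 𝓘(ℝ, E) 𝓘(ℝ, E) (chartAt E x₀).symm (chartAt E x₀).target) _ :=
      (contMDiffOn_chart_symm (n := ∞) (I := 𝓘(ℝ, E)) (x := x₀)).contMDiffOn_tangentMapWithin
        (m := ∞) (by simp) (chartAt E x₀).open_target.uniqueMDiffOn
    have h2 : ContMDiff 𝓘(ℝ, E) 𝓘(ℝ, E).tangent ∞
        (fun y ↦ (⟨y, u⟩ : TangentBundle 𝓘(ℝ, E) E)) := by
      intro y
      refine Bundle.contMDiffAt_totalSpace.2 ⟨contMDiffAt_id, ?_⟩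
      simpa using contMDiffAt_const
    refine (h1.comp (h2.contMDiffOn (s := (chartAt E x₀).target)) (fun y hy ↦ hy)).congr ?_
    intro y hy
    simp only [Function.comp_apply, tangentMapWithin]
    rw [mfderivWithin_of_mem_nhds ((chartAt E x₀).open_target.mem_nhds hy)]
  exact ContMDiffOn.inner_bundle (F := E) (E := fun x : M ↦ TangentSpace 𝓘(ℝ, E) x)
    (b := fun y ↦ (chartAt E x₀).symm y)
    (v := fun y ↦ mfderiv 𝓘(ℝ, E) 𝓘(ℝ, E) (chartAt E x₀).symm y u)
    (w := fun y ↦ mfderiv 𝓘(ℝ, E) 𝓘(ℝ, E) (chartAt E x₀).symm y w) (hsec u) (hsec w)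

end Charts

/-! ### Covariant derivative and geodesic equation in an arbitrary chart -/

section GeodesicEquation

variable {E : Type*} [NormedAddCommGroup E] [NormedSpace ℝ E] [FiniteDimensional ℝ E]
  {M : Type*} [TopologicalSpace M] [ChartedSpace E M] [IsManifold 𝓘(ℝ, E) ∞ M]
  [RiemannianBundle (fun x : M ↦ TangentSpace 𝓘(ℝ, E) x)]
  [IsContMDiffRiemannianBundle 𝓘(ℝ, E) ∞ E (fun x : M ↦ TangentSpace 𝓘(ℝ, E) x)]

theorem christoffel_eq_christoffelForm (x₀ : M) (y u w : E) :
    christoffel x₀ y u w = christoffelForm (metricInChart x₀) y u w := rfl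

theorem contDiffAt_metricInChart {x₀ : M} {y : E} (hy : y ∈ (chartAt E x₀).target) :
    ContDiffAt ℝ ∞ (metricInChart (E := E) x₀) y :=
  (contDiffOn_metricInChart x₀).contDiffAt ((chartAt E x₀).open_target.mem_nhds hy)

theorem contDiffAt_christoffelForm_metricInChart {x₀ : M} {y : E}
    (hy : y ∈ (chartAt E x₀).target) :
    ContDiffAt ℝ ∞ (christoffelForm (metricInChart (E := E) x₀)) y :=
  have : CompleteSpace E := FiniteDimensional.complete ℝ E
  contDiffAt_christoffelForm (contDiffAt_metricInChart hy) (metricInChart_isInvertible hy)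

theorem christoffel_symm {x₀ : M} {y : E} (hy : y ∈ (chartAt E x₀).target) (u w : E) :
    christoffel x₀ y u w = christoffel x₀ y w u :=
  christoffelForm_symm ((contDiffAt_metricInChart hy).differentiableAt (by simp))
    (.of_forall fun y ↦ metricInChart_symm x₀ y) u w

/-- The inhomogeneous second-derivative term is what makes the covariant derivative along a curve
independent of the chart. -/
theorem fderiv_transition_christoffel {x₀ x₁ m : M} (h₀ : m ∈ (chartAt E x₀).source)
    (h₁ : m ∈ (chartAt E x₁).source) (u w : E) :
    fderiv ℝ (transition x₀ x₁) (chartAt E x₀ m) (christoffel x₀ (chartAt E x₀ m) u w) =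
      christoffel x₁ (chartAt E x₁ m) (fderiv ℝ (transition x₀ x₁) (chartAt E x₀ m) u)
        (fderiv ℝ (transition x₀ x₁) (chartAt E x₀ m) w)
        + fderiv ℝ (fderiv ℝ (transition x₀ x₁)) (chartAt E x₀ m) u w := by
  have hy₀ := (chartAt E x₀).map_source h₀
  have hy₁ := (chartAt E x₁).map_source h₁
  have key := fderiv_christoffelForm_eq_add (g₀ := metricInChart (E := E) x₀)
    (g₁ := metricInChart (E := E) x₁) (ψ := transition x₀ x₁) (y := chartAt E x₀ m)
    ((contDiffAt_transition h₀ h₁).of_le (by norm_cast)) ?_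
    ((contDiffAt_metricInChart hy₀).differentiableAt (by simp)) ?_
    (metricInChart_isInvertible hy₀) ?_ (metricInChart_symm x₁ _) ?_ u w
  · rw [transition_chart h₀] at key
    exact key
  · rw [fderiv_transition h₀ h₁]
    exact ((chartDeriv_isInvertible h₁).comp (chartSymmDeriv_isInvertible h₀)).surjective
  · rw [transition_chart h₀]
    exact (contDiffAt_metricInChart hy₁).differentiableAt (by simp)
  · rw [transition_chart h₀]
    exact metricInChart_isInvertible hy₁
  · have hc : ContinuousAt (chartAt E x₀).symm (chartAt E x₀ m) :=
      (chartAt E x₀).continuousAt_symm hy₀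
    have hev : ∀ᶠ y in 𝓝 (chartAt E x₀ m), (chartAt E x₀).symm y ∈ (chartAt E x₁).source :=
      hc.eventually_mem (by
        rw [(chartAt E x₀).left_inv h₀]; exact (chartAt E x₁).open_source.mem_nhds h₁)
    filter_upwards [hev, (chartAt E x₀).open_target.mem_nhds hy₀] with y hy hyt u w
    have := metricInChart_transition ((chartAt E x₀).map_target hyt) hy u w
    rwa [(chartAt E x₀).right_inv hyt] at this

/-- Near a time at which the curve lies in the domains of two charts, its coordinates are related
by the change of coordinates. -/
theorem chart_comp_eventuallyEq {γ : ℝ → M} {t : ℝ} {x₀ : M} (x₁ : M)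
    (h₀ : γ t ∈ (chartAt E x₀).source) (hc : ContinuousAt γ t) :
    (chartAt E x₁ ∘ γ : ℝ → E) =ᶠ[𝓝 t] transition x₀ x₁ ∘ (chartAt E x₀ ∘ γ) := by
  filter_upwards [hc.eventually_mem ((chartAt E x₀).open_source.mem_nhds h₀)] with τ hτ
  exact (transition_chart hτ).symm

theorem hasDerivAt_chart_comp {γ : ℝ → M} {t : ℝ} {x₀ x₁ : M} {x' : E}
    (h₀ : γ t ∈ (chartAt E x₀).source) (h₁ : γ t ∈ (chartAt E x₁).source) (hc : ContinuousAt γ t)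
    (hx : HasDerivAt (chartAt E x₀ ∘ γ) x' t) :
    HasDerivAt (chartAt E x₁ ∘ γ)
      (fderiv ℝ (transition x₀ x₁) (chartAt E x₀ (γ t)) x') t :=
  (((contDiffAt_transition h₀ h₁).differentiableAt (by simp)).hasFDerivAt.comp_hasDerivAt t
    hx).congr_of_eventuallyEq (chart_comp_eventuallyEq x₁ h₀ hc)

set_option maxHeartbeats 1000000 in
/-- The covariant derivative along a curve, in an arbitrary chart. -/
theorem chartDeriv_covDerivAlong {γ : ℝ → M} {V : ∀ t, TangentSpace 𝓘(ℝ, E) (γ t)} {t : ℝ}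
    {x₀ : M} {x' v' : E} (h₀ : γ t ∈ (chartAt E x₀).source) (hc : ContinuousAt γ t)
    (hx : HasDerivAt (chartAt E x₀ ∘ γ) x' t)
    (hv : HasDerivAt (fun τ ↦ chartDeriv (E := E) x₀ (γ τ) (V τ)) v' t) :
    chartDeriv (E := E) x₀ (γ t) (covDerivAlong γ V t) =
      v' + christoffel x₀ (chartAt E x₀ (γ t)) x' (chartDeriv (E := E) x₀ (γ t) (V t)) := by
  have h₁ : γ t ∈ (chartAt E (γ t)).source := mem_chart_source E (γ t)
  have hx₁ := hasDerivAt_chart_comp h₀ h₁ hc hx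
  obtain ⟨ψ, hψ⟩ : ∃ ψ : E → E, ψ = transition x₀ (γ t) := ⟨_, rfl⟩
  rw [← hψ] at hx₁
  have hψs : ContDiffAt ℝ ∞ ψ (chartAt E x₀ (γ t)) := hψ ▸ contDiffAt_transition h₀ h₁
  have hdψ : HasFDerivAt (fderiv ℝ ψ) (fderiv ℝ (fderiv ℝ ψ) (chartAt E x₀ (γ t)))
      (chartAt E x₀ (γ t)) :=
    ((hψs.fderiv_right (m := 1) (by norm_cast)).differentiableAt (by norm_num)).hasFDerivAt
  have hev : (fun τ ↦ chartDeriv (E := E) (γ t) (γ τ) (V τ)) =ᶠ[𝓝 t]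
      fun τ ↦ fderiv ℝ ψ (chartAt E x₀ (γ τ)) (chartDeriv (E := E) x₀ (γ τ) (V τ)) := by
    filter_upwards [hc.eventually_mem ((chartAt E x₀).open_source.mem_nhds h₀),
      hc.eventually_mem ((chartAt E (γ t)).open_source.mem_nhds h₁)] with τ hτ₀ hτ₁
    rw [hψ, ← fderiv_transition_comp_chartDeriv hτ₀ hτ₁]
    rfl
  have hv₁ : HasDerivAt (fun τ ↦ chartDeriv (E := E) (γ t) (γ τ) (V τ))
      (fderiv ℝ (fderiv ℝ ψ) (chartAt E x₀ (γ t)) x' (chartDeriv (E := E) x₀ (γ t) (V t))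
        + fderiv ℝ ψ (chartAt E x₀ (γ t)) v') t :=
    ((hdψ.comp_hasDerivAt t hx).clm_apply hv).congr_of_eventuallyEq hev
  have hval : (covDerivAlong γ V t : E) =
      deriv (fun τ ↦ chartDeriv (E := E) (γ t) (γ τ) (V τ)) t + christoffel (γ t) (chartAt E (γ t) (γ t))
        (deriv (chartAt E (γ t) ∘ γ) t) (chartDeriv (E := E) (γ t) (γ t) (V t)) := rfl
  have hVt : chartDeriv (E := E) (γ t) (γ t) (V t) =
      fderiv ℝ ψ (chartAt E x₀ (γ t)) (chartDeriv (E := E) x₀ (γ t) (V t)) := hev.self_of_nhds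
  have hsum : (covDerivAlong γ V t : E) = fderiv ℝ ψ (chartAt E x₀ (γ t))
      (v' + christoffel x₀ (chartAt E x₀ (γ t)) x' (chartDeriv (E := E) x₀ (γ t) (V t))) := by
    -- Differentiating Dψ(v) along the curve produces D²ψ(x', v), precisely the inhomogeneous term
    -- of the transformation law.
    rw [hval, hv₁.deriv, hx₁.deriv, hVt, map_add, hψ, fderiv_transition_christoffel h₀ h₁]
    abel
  have hinv : ∀ e : E, chartDeriv (E := E) x₀ (γ t) (fderiv ℝ ψ (chartAt E x₀ (γ t)) e) = e := by
    intro e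
    rw [hψ, fderiv_transition h₀ h₁, chartDeriv_self, ContinuousLinearMap.id_comp]
    exact DFunLike.congr_fun (chartDeriv_chartSymmDeriv h₀) e
  exact (congrArg (chartDeriv (E := E) x₀ (γ t)) hsum).trans (hinv _)

theorem chartDeriv_velocity {γ : ℝ → M} {t : ℝ} {x₀ : M} (h₀ : γ t ∈ (chartAt E x₀).source)
    (hγ : MDifferentiableAt 𝓘(ℝ, ℝ) 𝓘(ℝ, E) γ t) :
    chartDeriv (E := E) x₀ (γ t) (velocity γ t) = deriv (chartAt E x₀ ∘ γ) t := by
  have h := mfderiv_comp (I := 𝓘(ℝ, ℝ)) (I' := 𝓘(ℝ, E)) (I'' := 𝓘(ℝ, E)) t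
    (g := chartAt E x₀) (f := γ) (mdifferentiableAt_chart h₀) hγ
  rw [mfderiv_eq_fderiv] at h
  have h2 := DFunLike.congr_fun h (1 : ℝ)
  rw [← fderiv_apply_one_eq_deriv]
  exact h2.symm

theorem hasDerivAt_fst {F G : Type*} [NormedAddCommGroup F] [NormedSpace ℝ F]
    [NormedAddCommGroup G] [NormedSpace ℝ G] {X : ℝ → F × G} {X' : F × G} {t : ℝ}
    (h : HasDerivAt X X' t) : HasDerivAt (fun τ ↦ (X τ).1) X'.1 t :=
  (ContinuousLinearMap.fst ℝ F G).hasFDerivAt.comp_hasDerivAt t h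

theorem hasDerivAt_snd {F G : Type*} [NormedAddCommGroup F] [NormedSpace ℝ F]
    [NormedAddCommGroup G] [NormedSpace ℝ G] {X : ℝ → F × G} {X' : F × G} {t : ℝ}
    (h : HasDerivAt X X' t) : HasDerivAt (fun τ ↦ (X τ).2) X'.2 t :=
  (ContinuousLinearMap.snd ℝ F G).hasFDerivAt.comp_hasDerivAt t h

/-- The coordinates of position and velocity of a curve in the chart at `x₀`. -/
def chartState (x₀ : M) (γ : ℝ → M) (t : ℝ) : E × E :=
  (chartAt E x₀ (γ t), deriv (chartAt E x₀ ∘ γ) t)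

/-- The geodesic spray in the chart at `x₀`. -/
def spray (x₀ : M) (z : E × E) : E × E := (z.2, -christoffel x₀ z.1 z.2 z.2)

/-- Near time `t`, the curve `γ` lies in the domain of the chart at `x₀` and solves the geodesic
equation there. -/
def SolvesGeodesicEq (x₀ : M) (γ : ℝ → M) (t : ℝ) : Prop :=
  ∀ᶠ τ in 𝓝 t, γ τ ∈ (chartAt E x₀).source ∧ ContinuousAt γ τ ∧
    HasDerivAt (chartState (E := E) x₀ γ) (spray x₀ (chartState x₀ γ τ)) τ

theorem contDiffAt_spray {x₀ : M} {z : E × E} (hz : z.1 ∈ (chartAt E x₀).target) :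
    ContDiffAt ℝ ∞ (spray (E := E) x₀) z := by
  have h1 : ContDiffAt ℝ ∞ (fun z : E × E ↦ christoffelForm (metricInChart (E := E) x₀) z.1) z :=
    (contDiffAt_christoffelForm_metricInChart hz).comp z contDiffAt_fst
  exact contDiffAt_snd.prodMk ((h1.clm_apply contDiffAt_snd).clm_apply contDiffAt_snd).neg

theorem fderiv_spray {x₀ : M} {z : E × E} (hz : z.1 ∈ (chartAt E x₀).target) (j : E × E) :
    fderiv ℝ (spray (E := E) x₀) z j =
      (j.2, -(fderiv ℝ (christoffelForm (metricInChart (E := E) x₀)) z.1 j.1 z.2 z.2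
        + christoffel x₀ z.1 j.2 z.2 + christoffel x₀ z.1 z.2 j.2)) := by
  have h1 : HasFDerivAt (fun z : E × E ↦ christoffelForm (metricInChart (E := E) x₀) z.1)
      ((fderiv ℝ (christoffelForm (metricInChart (E := E) x₀)) z.1).comp
        (ContinuousLinearMap.fst ℝ E E)) z :=
    ((contDiffAt_christoffelForm_metricInChart hz).differentiableAt (by simp)).hasFDerivAt.comp z
      hasFDerivAt_fst
  have h2 : HasFDerivAt (spray (E := E) x₀) _ z :=
    HasFDerivAt.prodMk hasFDerivAt_snd
      ((h1.clm_apply hasFDerivAt_snd).clm_apply hasFDerivAt_snd).neg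
  rw [h2.fderiv]
  simp only [ContinuousLinearMap.prod_apply, ContinuousLinearMap.coe_snd', neg_apply,
    add_apply, ContinuousLinearMap.comp_apply, ContinuousLinearMap.flip_apply,
    ContinuousLinearMap.coe_fst', christoffel_eq_christoffelForm]
  congr 2
  abel

theorem SolvesGeodesicEq.eventually {x₀ : M} {γ : ℝ → M} {t : ℝ}
    (h : SolvesGeodesicEq (E := E) x₀ γ t) :
    ∀ᶠ τ in 𝓝 t, SolvesGeodesicEq (E := E) x₀ γ τ := eventually_eventually_nhds.2 h

theorem SolvesGeodesicEq.congr {x₀ : M} {γ γ' : ℝ → M} {t : ℝ}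
    (h : SolvesGeodesicEq (E := E) x₀ γ t) (he : γ' =ᶠ[𝓝 t] γ) :
    SolvesGeodesicEq (E := E) x₀ γ' t := by
  filter_upwards [h, eventually_eventually_nhds.2 he] with τ hτ heτ'
  have heτ : γ' =ᶠ[𝓝 τ] γ := heτ'
  have hst : chartState (E := E) x₀ γ' =ᶠ[𝓝 τ] chartState (E := E) x₀ γ := by
    filter_upwards [eventually_eventually_nhds.2 heτ'] with σ hσ
    have hσ' : γ' =ᶠ[𝓝 σ] γ := hσ
    have : (chartAt E x₀ ∘ γ' : ℝ → E) =ᶠ[𝓝 σ] chartAt E x₀ ∘ γ := hσ'.fun_comp _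
    rw [chartState, chartState, this.deriv_eq, hσ'.self_of_nhds]
  refine ⟨heτ.self_of_nhds ▸ hτ.1, hτ.2.1.congr heτ.symm, ?_⟩
  rw [hst.self_of_nhds]
  exact hτ.2.2.congr_of_eventuallyEq hst

theorem ContMDiffAt.contDiffAt_chart_comp {γ : ℝ → M} {t : ℝ} {x₀ : M} {n : ℕ∞}
    (hγ : ContMDiffAt 𝓘(ℝ, ℝ) 𝓘(ℝ, E) n γ t) (h₀ : γ t ∈ (chartAt E x₀).source) :
    ContDiffAt ℝ n (chartAt E x₀ ∘ γ : ℝ → E) t := by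
  rw [← contMDiffAt_iff_contDiffAt]
  exact ((contMDiffAt_chart h₀).of_le (by exact_mod_cast le_top)).comp t hγ

/-- `IsGeodesicOn` uses, at each time, the chart at the current point, whereas ODE theory needs one
fixed chart during a time interval. The passage is `chartDeriv_covDerivAlong`. -/
theorem IsGeodesicOn.solvesGeodesicEq {γ : ℝ → M} {s : Set ℝ} (hs : IsOpen s)
    (h : IsGeodesicOn (E := E) γ s) {t : ℝ} (ht : t ∈ s) {x₀ : M}
    (h₀ : γ t ∈ (chartAt E x₀).source) : SolvesGeodesicEq (E := E) x₀ γ t := by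
  have hC : ∀ τ ∈ s, ContMDiffAt 𝓘(ℝ, ℝ) 𝓘(ℝ, E) 2 γ τ := fun τ hτ ↦
    h.1.contMDiffAt (hs.mem_nhds hτ)
  have hgood : ∀ᶠ τ in 𝓝 t, τ ∈ s ∧ γ τ ∈ (chartAt E x₀).source :=
    (hs.eventually_mem ht).and ((hC t ht).continuousAt.eventually_mem
      ((chartAt E x₀).open_source.mem_nhds h₀))
  filter_upwards [hgood, eventually_eventually_nhds.2 hgood] with τ hτ hev
  refine ⟨hτ.2, (hC τ hτ.1).continuousAt, ?_⟩
  have hx2 : ContDiffAt ℝ 2 (chartAt E x₀ ∘ γ : ℝ → E) τ :=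
    ContMDiffAt.contDiffAt_chart_comp (n := 2) (hC τ hτ.1) hτ.2
  have hx : HasDerivAt (chartAt E x₀ ∘ γ : ℝ → E) (deriv (chartAt E x₀ ∘ γ) τ) τ :=
    (hx2.differentiableAt (by norm_num)).hasDerivAt
  have hv : HasDerivAt (deriv (chartAt E x₀ ∘ γ : ℝ → E))
      (deriv (deriv (chartAt E x₀ ∘ γ)) τ) τ := by
    have h1 : ContDiffAt ℝ 1 (fun σ ↦ fderiv ℝ (chartAt E x₀ ∘ γ : ℝ → E) σ 1) τ :=
      (hx2.fderiv_right (m := 1) (by norm_num)).clm_apply contDiffAt_const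
    simp only [fderiv_apply_one_eq_deriv] at h1
    exact (h1.differentiableAt (by norm_num)).hasDerivAt
  have hvel : (fun σ ↦ chartDeriv (E := E) x₀ (γ σ) (velocity (E := E) γ σ)) =ᶠ[𝓝 τ]
      deriv (chartAt E x₀ ∘ γ : ℝ → E) := by
    filter_upwards [hev] with σ hσ
    exact chartDeriv_velocity hσ.2 ((hC σ hσ.1).mdifferentiableAt (by norm_num))
  have hcov := chartDeriv_covDerivAlong hτ.2 (hC τ hτ.1).continuousAt hx
    (hv.congr_of_eventuallyEq hvel)
  have hz : chartDeriv (E := E) x₀ (γ τ) (covDerivAlong (E := E) γ (velocity γ) τ) = 0 :=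
    (congrArg (chartDeriv (E := E) x₀ (γ τ)) (h.2 τ hτ.1)).trans (map_zero (chartDeriv (E := E) x₀ (γ τ)))
  rw [hz] at hcov
  have hve : chartDeriv (E := E) x₀ (γ τ) (velocity (E := E) γ τ) = deriv (chartAt E x₀ ∘ γ) τ :=
    hvel.self_of_nhds
  rw [hve] at hcov
  have hd2 : deriv (deriv (chartAt E x₀ ∘ γ : ℝ → E)) τ = -christoffel x₀ (chartAt E x₀ (γ τ))
      (deriv (chartAt E x₀ ∘ γ) τ) (deriv (chartAt E x₀ ∘ γ) τ) :=
    eq_neg_of_add_eq_zero_left hcov.symm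
  rw [hd2] at hv
  exact hx.prodMk hv

/-- Bootstrapping: the state is continuous, so its derivative, the spray along it, is continuous;
the state is thus C¹, and its second component is the derivative of the first. This supplies the
regularity that `IsGeodesicOn` demands. -/
theorem SolvesGeodesicEq.contDiffAt {x₀ : M} {γ : ℝ → M} {t : ℝ}
    (h : SolvesGeodesicEq (E := E) x₀ γ t) :
    ContDiffAt ℝ 2 (chartAt E x₀ ∘ γ : ℝ → E) t := by
  obtain ⟨u, hu, huo, htu⟩ := eventually_nhds_iff.1 h
  have hst : ∀ τ ∈ u, HasDerivAt (chartState (E := E) x₀ γ) (spray x₀ (chartState x₀ γ τ)) τ :=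
    fun τ hτ ↦ (hu τ hτ).2.2
  have hcont : ContinuousOn (chartState (E := E) x₀ γ) u := fun τ hτ ↦
    (hst τ hτ).continuousAt.continuousWithinAt
  have h1 : ContDiffOn ℝ 1 (chartState (E := E) x₀ γ) u := by
    rw [show (1 : ℕ∞ω) = 0 + 1 by norm_num, contDiffOn_succ_iff_deriv_of_isOpen huo]
    refine ⟨fun τ hτ ↦ (hst τ hτ).differentiableAt.differentiableWithinAt, by simp, ?_⟩
    rw [contDiffOn_zero]
    refine ContinuousOn.congr (f := fun τ ↦ spray (E := E) x₀ (chartState x₀ γ τ)) ?_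
      fun τ hτ ↦ (hst τ hτ).deriv
    intro τ hτ
    exact ((contDiffAt_spray (x₀ := x₀) (z := chartState (E := E) x₀ γ τ)
      ((chartAt E x₀).map_source (hu τ hτ).1)).continuousAt.comp
      (hst τ hτ).continuousAt).continuousWithinAt
  have h2 : ContDiffOn ℝ 2 (chartAt E x₀ ∘ γ : ℝ → E) u := by
    rw [show (2 : ℕ∞ω) = 1 + 1 by norm_num, contDiffOn_succ_iff_deriv_of_isOpen huo]
    exact ⟨fun τ hτ ↦ (hasDerivAt_fst (hst τ hτ)).differentiableAt.differentiableWithinAt, by simp, h1.snd⟩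
  exact h2.contDiffAt (huo.mem_nhds htu)

theorem SolvesGeodesicEq.contMDiffAt {x₀ : M} {γ : ℝ → M} {t : ℝ}
    (h : SolvesGeodesicEq (E := E) x₀ γ t) : ContMDiffAt 𝓘(ℝ, ℝ) 𝓘(ℝ, E) 2 γ t := by
  have h2 := h.contDiffAt
  rw [← contMDiffAt_iff_contDiffAt] at h2
  have h3 : ContMDiffAt 𝓘(ℝ, ℝ) 𝓘(ℝ, E) 2 ((chartAt E x₀).symm ∘ (chartAt E x₀ ∘ γ)) t :=
    ((contMDiffAt_chart_symm ((chartAt E x₀).map_source h.self_of_nhds.1)).of_le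
      (by norm_cast)).comp t h2
  refine h3.congr_of_eventuallyEq ?_
  filter_upwards [h] with τ hτ
  exact ((chartAt E x₀).left_inv hτ.1).symm

theorem isGeodesicOn_of_solvesGeodesicEq {γ : ℝ → M} {s : Set ℝ}
    (h : ∀ t ∈ s, ∃ x₀ : M, SolvesGeodesicEq (E := E) x₀ γ t) : IsGeodesicOn (E := E) γ s := by
  refine ⟨fun t ht ↦ ?_, fun t ht ↦ ?_⟩
  · obtain ⟨x₀, hx₀⟩ := h t ht
    exact hx₀.contMDiffAt.contMDiffWithinAt
  · obtain ⟨x₀, hx₀⟩ := h t ht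
    obtain ⟨hm, hc, hst⟩ := hx₀.self_of_nhds
    have hvel : (fun σ ↦ chartDeriv (E := E) x₀ (γ σ) (velocity (E := E) γ σ)) =ᶠ[𝓝 t]
        deriv (chartAt E x₀ ∘ γ : ℝ → E) := by
      filter_upwards [hx₀.eventually] with σ hσ
      exact chartDeriv_velocity hσ.self_of_nhds.1 (hσ.contMDiffAt.mdifferentiableAt (by norm_num))
    have hcov := chartDeriv_covDerivAlong hm hc (hasDerivAt_fst hst) ((hasDerivAt_snd hst).congr_of_eventuallyEq hvel)
    have hve : chartDeriv (E := E) x₀ (γ t) (velocity (E := E) γ t) = deriv (chartAt E x₀ ∘ γ) t :=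
      hvel.self_of_nhds
    rw [hve] at hcov
    apply (chartDeriv_isInvertible hm).injective
    refine hcov.trans (Eq.trans ?_ (map_zero (chartDeriv (E := E) x₀ (γ t))).symm)
    exact neg_add_cancel _

/-- Whether a curve solves the geodesic equation does not depend on the chart. -/
theorem SolvesGeodesicEq.change_chart {x₀ x₁ : M} {γ : ℝ → M} {t : ℝ}
    (h : SolvesGeodesicEq (E := E) x₀ γ t) (h₁ : γ t ∈ (chartAt E x₁).source) :
    SolvesGeodesicEq (E := E) x₁ γ t := by
  obtain ⟨u, hu, huo, htu⟩ := eventually_nhds_iff.1 h.eventually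
  exact (isGeodesicOn_of_solvesGeodesicEq fun τ hτ ↦ ⟨x₀, hu τ hτ⟩).solvesGeodesicEq huo htu h₁

/-- The change of coordinates from the chart at `x₀` to the chart at `x₁`, on tangent vectors. -/
def stateTransition (x₀ x₁ : M) (z : E × E) : E × E :=
  (transition x₀ x₁ z.1, fderiv ℝ (transition x₀ x₁) z.1 z.2)

theorem contDiffAt_stateTransition {x₀ x₁ m : M} {v : E} (h₀ : m ∈ (chartAt E x₀).source)
    (h₁ : m ∈ (chartAt E x₁).source) :
    ContDiffAt ℝ 1 (stateTransition (E := E) x₀ x₁) (chartAt E x₀ m, v) := by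
  have hψ : ContDiffAt ℝ ∞ (transition x₀ x₁ : E → E) ((chartAt E x₀ m, v) : E × E).1 :=
    contDiffAt_transition h₀ h₁
  refine ContDiffAt.prodMk ((hψ.of_le (by norm_cast)).comp (chartAt E x₀ m, v) contDiffAt_fst) ?_
  exact ((hψ.fderiv_right (m := 1) (by norm_cast)).comp (chartAt E x₀ m, v)
    contDiffAt_fst).clm_apply contDiffAt_snd

theorem SolvesGeodesicEq.chartState_eq {x₀ x₁ : M} {γ : ℝ → M} {t : ℝ}
    (h : SolvesGeodesicEq (E := E) x₀ γ t) (h₁ : γ t ∈ (chartAt E x₁).source) :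
    chartState (E := E) x₁ γ t = stateTransition x₀ x₁ (chartState x₀ γ t) := by
  obtain ⟨hm, hc, hst⟩ := h.self_of_nhds
  exact Prod.ext (transition_chart hm).symm (hasDerivAt_chart_comp hm h₁ hc (hasDerivAt_fst hst)).deriv

end GeodesicEquation

/-! ### Uniqueness and reparametrization of geodesics -/

section Uniqueness

variable {E : Type*} [NormedAddCommGroup E] [NormedSpace ℝ E] [FiniteDimensional ℝ E]
  {M : Type*} [TopologicalSpace M] [ChartedSpace E M] [IsManifold 𝓘(ℝ, E) ∞ M]
  [RiemannianBundle (fun x : M ↦ TangentSpace 𝓘(ℝ, E) x)]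
  [IsContMDiffRiemannianBundle 𝓘(ℝ, E) ∞ E (fun x : M ↦ TangentSpace 𝓘(ℝ, E) x)]

/-- Local uniqueness of geodesics. -/
theorem SolvesGeodesicEq.eventuallyEq {x₀ : M} {γ γ' : ℝ → M} {t : ℝ}
    (h : SolvesGeodesicEq (E := E) x₀ γ t) (h' : SolvesGeodesicEq (E := E) x₀ γ' t)
    (heq : chartState (E := E) x₀ γ t = chartState x₀ γ' t) : γ =ᶠ[𝓝 t] γ' := by
  have hz : (chartState (E := E) x₀ γ t).1 ∈ (chartAt E x₀).target :=
    (chartAt E x₀).map_source h.self_of_nhds.1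
  obtain ⟨K, s, hs, hlip⟩ :=
    ((contDiffAt_spray hz).of_le (by norm_cast : (1 : ℕ∞ω) ≤ ∞)).exists_lipschitzOnWith
  have hc := h.self_of_nhds.2.2.continuousAt
  have hc' := h'.self_of_nhds.2.2.continuousAt
  have hst : chartState (E := E) x₀ γ =ᶠ[𝓝 t] chartState x₀ γ' := by
    refine ODE_solution_unique_of_eventually (v := fun _ ↦ spray x₀) (s := fun _ ↦ s) (K := K)
      (.of_forall fun _ ↦ hlip) ?_ ?_ heq
    · filter_upwards [h, hc.eventually_mem hs] with τ h1 h2 using ⟨h1.2.2, h2⟩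
    · filter_upwards [h', hc'.eventually_mem (heq ▸ hs)] with τ h1 h2 using ⟨h1.2.2, h2⟩
  filter_upwards [h, h', hst] with τ h1 h2 h3
  exact (chartAt E x₀).injOn h1.1 h2.1 (congrArg Prod.fst h3)

theorem chartState_eq_of_eventuallyEq {x₀ : M} {γ γ' : ℝ → M} {t : ℝ} (h : γ =ᶠ[𝓝 t] γ') :
    chartState (E := E) x₀ γ t = chartState x₀ γ' t := by
  have : (chartAt E x₀ ∘ γ : ℝ → E) =ᶠ[𝓝 t] chartAt E x₀ ∘ γ' := h.fun_comp _
  rw [chartState, chartState, this.deriv_eq, h.self_of_nhds]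

/-- Uniqueness of geodesics on connected sets of times. -/
theorem eventuallyEq_of_solvesGeodesicEq [T2Space M] {γ γ' : ℝ → M} {s : Set ℝ}
    (hs : IsPreconnected s) (h : ∀ t ∈ s, ∃ x₀ : M, SolvesGeodesicEq (E := E) x₀ γ t)
    (h' : ∀ t ∈ s, ∃ x₀ : M, SolvesGeodesicEq (E := E) x₀ γ' t) {t₀ : ℝ} (ht₀ : t₀ ∈ s)
    (heq : γ =ᶠ[𝓝 t₀] γ') {t : ℝ} (ht : t ∈ s) : γ =ᶠ[𝓝 t] γ' := by
  -- Times at which the germs agree form an open set. So do the others: by local uniqueness,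
  -- geodesics with different germs differ in position or, in a common chart, in state, and this
  -- persists nearby by continuity.
  refine (hs.induction₂ (fun t t' ↦ (γ =ᶠ[𝓝 t] γ' ↔ γ =ᶠ[𝓝 t'] γ')) ?_
    (fun _ _ _ _ _ _ h1 h2 ↦ h1.trans h2) (fun _ _ _ _ h ↦ h.symm) ht₀ ht).1 heq
  intro t ht
  apply nhdsWithin_le_nhds
  by_cases hE : γ =ᶠ[𝓝 t] γ'
  · filter_upwards [eventually_eventually_nhds.2 hE] with t' ht' using ⟨fun _ ↦ ht', fun _ ↦ hE⟩
  · obtain ⟨x, hx⟩ := h t ht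
    obtain ⟨x', hx'⟩ := h' t ht
    by_cases hp : γ t = γ' t
    · have hm : γ t ∈ (chartAt E (γ t)).source := mem_chart_source E (γ t)
      have hs₁ : SolvesGeodesicEq (E := E) (γ t) γ t := hx.change_chart hm
      have hs₂ : SolvesGeodesicEq (E := E) (γ t) γ' t := hx'.change_chart (hp ▸ hm)
      have hne : chartState (E := E) (γ t) γ t ≠ chartState (γ t) γ' t := fun h ↦
        hE (hs₁.eventuallyEq hs₂ h)
      filter_upwards [(hs₁.self_of_nhds.2.2.continuousAt.ne_iff_eventually_ne
        hs₂.self_of_nhds.2.2.continuousAt).1 hne] with t' ht'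
      exact ⟨fun h ↦ (hE h).elim, fun h ↦ (ht' (chartState_eq_of_eventuallyEq h)).elim⟩
    · filter_upwards [(hx.self_of_nhds.2.1.ne_iff_eventually_ne hx'.self_of_nhds.2.1).1 hp]
        with t' ht'
      exact ⟨fun h ↦ (hE h).elim, fun h ↦ (ht' h.self_of_nhds).elim⟩

theorem chartState_comp_mul_add (x₀ : M) (γ : ℝ → M) (a b t : ℝ) :
    chartState (E := E) x₀ (fun τ ↦ γ (a * τ + b)) t =
      ((chartState (E := E) x₀ γ (a * t + b)).1, a • (chartState (E := E) x₀ γ (a * t + b)).2) := by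
  have h : deriv (fun τ ↦ (chartAt E x₀ ∘ γ : ℝ → E) (a * τ + b)) t =
      a • deriv (chartAt E x₀ ∘ γ : ℝ → E) (a * t + b) := by
    have h1 := deriv_comp_mul_left a (fun τ ↦ (chartAt E x₀ ∘ γ : ℝ → E) (τ + b)) t
    rw [deriv_comp_add_const] at h1
    exact h1
  exact Prod.ext rfl h

/-- Affine reparametrizations of geodesics are geodesics. -/
theorem SolvesGeodesicEq.comp_mul_add {x₀ : M} {γ : ℝ → M} {a b t : ℝ}
    (h : SolvesGeodesicEq (E := E) x₀ γ (a * t + b)) :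
    SolvesGeodesicEq (E := E) x₀ (fun τ ↦ γ (a * τ + b)) t := by
  have hc : Continuous fun τ : ℝ ↦ a * τ + b := by fun_prop
  filter_upwards [hc.continuousAt.eventually h] with τ hτ
  refine ⟨hτ.1, ContinuousAt.comp (f := fun τ : ℝ ↦ a * τ + b) hτ.2.1 hc.continuousAt, ?_⟩
  have haff : HasDerivAt (fun τ : ℝ ↦ a * τ + b) a τ := by
    simpa using ((hasDerivAt_id τ).const_mul a).add_const b
  have h1 := HasDerivAt.scomp (h := fun τ : ℝ ↦ a * τ + b) τ hτ.2.2 haff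
  have h2 := (hasDerivAt_fst h1).prodMk ((hasDerivAt_snd h1).const_smul a)
  have hfun : chartState (E := E) x₀ (fun τ ↦ γ (a * τ + b)) = fun τ ↦
      ((chartState (E := E) x₀ γ (a * τ + b)).1, a • (chartState (E := E) x₀ γ (a * τ + b)).2) :=
    funext fun τ ↦ chartState_comp_mul_add x₀ γ a b τ
  rw [hfun]
  refine h2.congr_deriv ?_
  -- The acceleration scales by a², as does the Christoffel term, which is quadratic in the
  -- velocity.
  simp only [spray, Prod.smul_fst, Prod.smul_snd, christoffel_eq_christoffelForm, map_smul,
    smul_apply, smul_neg]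

/-- `γ` is a geodesic on the open interval `(a, b)` around `0` that starts from `q` with
velocity `v`. -/
structure GeodesicFrom (q : M) (v : E) (γ : ℝ → M) (a b : ℝ) : Prop where
  zero_mem : (0 : ℝ) ∈ Ioo a b
  solves : ∀ t ∈ Ioo a b, ∃ x₀ : M, SolvesGeodesicEq (E := E) x₀ γ t
  start : γ 0 = q
  chartState_zero : chartState (E := E) q γ 0 = (chartAt E q q, v)

theorem GeodesicFrom.solvesGeodesicEq {q : M} {v : E} {γ : ℝ → M} {a b : ℝ}
    (h : GeodesicFrom q v γ a b) {t : ℝ} (ht : t ∈ Ioo a b) {x₁ : M}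
    (h₁ : γ t ∈ (chartAt E x₁).source) : SolvesGeodesicEq (E := E) x₁ γ t := by
  obtain ⟨x₀, hx₀⟩ := h.solves t ht
  exact hx₀.change_chart h₁

theorem GeodesicFrom.solvesGeodesicEq_zero {q : M} {v : E} {γ : ℝ → M} {a b : ℝ}
    (h : GeodesicFrom q v γ a b) : SolvesGeodesicEq (E := E) q γ 0 :=
  h.solvesGeodesicEq h.zero_mem (h.start ▸ mem_chart_source E (γ 0))

theorem GeodesicFrom.eventuallyEq [T2Space M] {q : M} {v : E} {γ γ' : ℝ → M} {a b a' b' : ℝ}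
    (h : GeodesicFrom q v γ a b) (h' : GeodesicFrom q v γ' a' b') {t : ℝ} (ht : t ∈ Ioo a b)
    (ht' : t ∈ Ioo a' b') : γ =ᶠ[𝓝 t] γ' := by
  have hs : IsPreconnected (Ioo a b ∩ Ioo a' b') := by
    rw [Ioo_inter_Ioo]; exact isPreconnected_Ioo
  exact eventuallyEq_of_solvesGeodesicEq hs (fun t ht ↦ h.solves t ht.1)
    (fun t ht ↦ h'.solves t ht.2) ⟨h.zero_mem, h'.zero_mem⟩
    (h.solvesGeodesicEq_zero.eventuallyEq h'.solvesGeodesicEq_zero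
      (h.chartState_zero.trans h'.chartState_zero.symm)) ⟨ht, ht'⟩

/-- The times τ with T τ in (a, b) form an open set containing 0 and 1, hence by convexity an
ε-enlargement of [0, 1]. No sign of T is assumed. -/
theorem GeodesicFrom.comp_mul {q : M} {v : E} {γ : ℝ → M} {a b T : ℝ}
    (h : GeodesicFrom q v γ a b) (hT : T ∈ Ioo a b) :
    ∃ ε > 0, GeodesicFrom q (T • v) (fun τ ↦ γ (T * τ)) (0 - ε) (1 + ε) := by
  have hcont : Continuous fun τ : ℝ ↦ T * τ := by fun_prop
  have hopen : IsOpen ((fun τ : ℝ ↦ T * τ) ⁻¹' Ioo a b) := isOpen_Ioo.preimage hcont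
  have hm0 : (0 : ℝ) ∈ (fun τ : ℝ ↦ T * τ) ⁻¹' Ioo a b := by simpa using h.zero_mem
  have hm1 : (1 : ℝ) ∈ (fun τ : ℝ ↦ T * τ) ⁻¹' Ioo a b := by simpa using hT
  obtain ⟨ε₀, hε₀, hb₀⟩ := Metric.isOpen_iff.1 hopen 0 hm0
  obtain ⟨ε₁, hε₁, hb₁⟩ := Metric.isOpen_iff.1 hopen 1 hm1
  have hmem : ∀ τ ∈ Ioo (0 - min ε₀ ε₁) (1 + min ε₀ ε₁), T * τ ∈ Ioo a b := by
    intro τ hτ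
    have hle₀ := min_le_left ε₀ ε₁
    have hle₁ := min_le_right ε₀ ε₁
    rcases lt_or_ge τ 0 with hneg | hpos
    · refine hb₀ ?_
      rw [Real.ball_eq_Ioo]
      exact ⟨by linarith [hτ.1], by linarith⟩
    rcases lt_or_ge 1 τ with hgt | hle
    · refine hb₁ ?_
      rw [Real.ball_eq_Ioo]
      exact ⟨by linarith, by linarith [hτ.2]⟩
    · have := (convex_Ioo a b) h.zero_mem hT (sub_nonneg.2 hle) hpos (by ring)
      simpa [mul_comm] using this
  have haff : (fun τ ↦ γ (T * τ)) = fun τ ↦ γ (T * τ + 0) := by simp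
  refine ⟨min ε₀ ε₁, by positivity, ⟨by simp [hε₀, hε₁], by
    have := lt_min hε₀ hε₁; linarith⟩, fun τ hτ ↦ ?_, by simpa using h.start, ?_⟩
  · obtain ⟨x₀, hx₀⟩ := h.solves _ (hmem τ hτ)
    rw [haff]
    exact ⟨x₀, SolvesGeodesicEq.comp_mul_add (by simpa using hx₀)⟩
  · rw [haff, chartState_comp_mul_add, mul_zero, add_zero, h.chartState_zero]

/-- An equality of tangent vectors over points that are not syntactically equal becomes an equality
in E, as the chart at q has identity differential at q. -/
theorem mk_velocity_eq_iff {q : M} {v : TangentSpace 𝓘(ℝ, E) q} {γ : ℝ → M} {t : ℝ}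
    (hγ : MDifferentiableAt 𝓘(ℝ, ℝ) 𝓘(ℝ, E) γ t) :
    (⟨γ t, velocity γ t⟩ : TangentBundle 𝓘(ℝ, E) M) = ⟨q, v⟩ ↔
      γ t = q ∧ chartState (E := E) q γ t = (chartAt E q q, v) := by
  have hvel := chartDeriv_velocity (mem_chart_source E (γ t)) hγ
  rw [chartDeriv_self] at hvel
  have hvel' : (velocity γ t : E) = deriv (chartAt E (γ t) ∘ γ) t := hvel
  constructor
  · intro h
    have hp : γ t = q := congrArg TotalSpace.proj h
    subst hp
    have hv : velocity γ t = v := by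
      have := (TotalSpace.mk.injEq _ _ _ _).mp h
      exact eq_of_heq this.2
    refine ⟨rfl, Prod.ext rfl ?_⟩
    exact hvel'.symm.trans hv
  · rintro ⟨rfl, h⟩
    have : (velocity γ t : E) = v := hvel'.trans (congrArg Prod.snd h)
    exact congrArg (TotalSpace.mk (γ t)) this

theorem isGeodesicFrom_iff {q : M} {v : TangentSpace 𝓘(ℝ, E) q} {γ : ℝ → M} :
    IsGeodesicFrom q v γ ↔ ∃ ε > 0, GeodesicFrom (E := E) q v γ (0 - ε) (1 + ε) := by
  constructor
  · rintro ⟨⟨ε, hε, hg⟩, hst⟩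
    have h0 : (0 : ℝ) ∈ Ioo (0 - ε) (1 + ε) := ⟨by linarith, by linarith⟩
    have hd : MDifferentiableAt 𝓘(ℝ, ℝ) 𝓘(ℝ, E) γ 0 :=
      (hg.1.contMDiffAt (isOpen_Ioo.mem_nhds h0)).mdifferentiableAt (by norm_num)
    obtain ⟨h1, h2⟩ := (mk_velocity_eq_iff hd).1 hst
    exact ⟨ε, hε, h0, fun t ht ↦
      ⟨γ t, hg.solvesGeodesicEq isOpen_Ioo ht (mem_chart_source E (γ t))⟩, h1, h2⟩
  · rintro ⟨ε, hε, h⟩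
    exact ⟨⟨ε, hε, isGeodesicOn_of_solvesGeodesicEq h.solves⟩,
      (mk_velocity_eq_iff
        (h.solvesGeodesicEq_zero.contMDiffAt.mdifferentiableAt (by norm_num))).2
        ⟨h.start, h.chartState_zero⟩⟩

theorem GeodesicFrom.smul_mem_expDomain {q : M} {v : TangentSpace 𝓘(ℝ, E) q} {γ : ℝ → M}
    {a b T : ℝ} (h : GeodesicFrom (E := E) q v γ a b) (hT : T ∈ Ioo a b) :
    T • v ∈ expDomain q :=
  ⟨_, isGeodesicFrom_iff.2 (h.comp_mul hT)⟩

/-- The geodesic from `q` with velocity `v` is `t ↦ Exp_q (t v)`. -/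
theorem GeodesicFrom.expMap_smul [T2Space M] {q : M} {v : TangentSpace 𝓘(ℝ, E) q} {γ : ℝ → M}
    {a b T : ℝ} (h : GeodesicFrom (E := E) q v γ a b) (hT : T ∈ Ioo a b) :
    expMap q (T • v) = γ T := by
  have hex : ∃ γ : ℝ → M, IsGeodesicFrom q (T • v) γ := h.smul_mem_expDomain hT
  obtain ⟨ε, hε, hg⟩ := h.comp_mul hT
  -- `expMap` evaluates a geodesic picked by choice; uniqueness makes the choice immaterial.
  obtain ⟨ε', hε', hg'⟩ := isGeodesicFrom_iff.1 hex.choose_spec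
  rw [expMap, dif_pos hex]
  have := (hg'.eventuallyEq hg (t := 1) ⟨by linarith, by linarith⟩
    ⟨by linarith, by linarith⟩).self_of_nhds
  simpa using this

theorem exists_geodesicFrom_of_mem_expDomain {q : M} {v : TangentSpace 𝓘(ℝ, E) q}
    (hv : v ∈ expDomain q) :
    ∃ γ : ℝ → M, ∃ ε > 0, GeodesicFrom (E := E) q v γ (0 - ε) (1 + ε) := by
  obtain ⟨γ, hγ⟩ := hv
  exact ⟨γ, isGeodesicFrom_iff.1 hγ⟩

end Uniqueness

/-! ### Dependence of geodesics on the initial velocity -/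

section SmoothDependence

variable {E : Type*} [NormedAddCommGroup E] [NormedSpace ℝ E] [FiniteDimensional ℝ E]
  {M : Type*} [TopologicalSpace M] [ChartedSpace E M] [IsManifold 𝓘(ℝ, E) ∞ M]
  [RiemannianBundle (fun x : M ↦ TangentSpace 𝓘(ℝ, E) x)]
  [IsContMDiffRiemannianBundle 𝓘(ℝ, E) ∞ E (fun x : M ↦ TangentSpace 𝓘(ℝ, E) x)]

/-- A solution of the spray equation in a chart is a geodesic of the manifold. -/
theorem solvesGeodesicEq_of_hasDerivAt_spray {x₁ : M} {X : ℝ → E × E} {s : Set ℝ} (hs : IsOpen s)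
    (hX : ∀ t ∈ s, (X t).1 ∈ (chartAt E x₁).target ∧ HasDerivAt X (spray x₁ (X t)) t)
    {t : ℝ} (ht : t ∈ s) :
    SolvesGeodesicEq (E := E) x₁ (fun τ ↦ (chartAt E x₁).symm (X τ).1) t ∧
      chartState (E := E) x₁ (fun τ ↦ (chartAt E x₁).symm (X τ).1) t = X t := by
  have hstate : ∀ τ ∈ s,
      chartState (E := E) x₁ (fun τ ↦ (chartAt E x₁).symm (X τ).1) τ = X τ := by
    intro τ hτ
    have he : (chartAt E x₁ ∘ fun τ ↦ (chartAt E x₁).symm (X τ).1) =ᶠ[𝓝 τ] fun τ ↦ (X τ).1 := by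
      filter_upwards [hs.mem_nhds hτ] with σ hσ
      exact (chartAt E x₁).right_inv (hX σ hσ).1
    exact Prod.ext he.self_of_nhds
      (he.deriv_eq.trans (hasDerivAt_fst (hX τ hτ).2).deriv)
  refine ⟨?_, hstate t ht⟩
  filter_upwards [hs.mem_nhds ht] with τ hτ
  refine ⟨(chartAt E x₁).map_target (hX τ hτ).1, ?_, ?_⟩
  · exact ContinuousAt.comp (f := fun τ ↦ (X τ).1)
      ((chartAt E x₁).continuousAt_symm (hX τ hτ).1)
      (hasDerivAt_fst (hX τ hτ).2).continuousAt
  · rw [hstate τ hτ]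
    refine (hX τ hτ).2.congr_of_eventuallyEq ?_
    filter_upwards [hs.mem_nhds hτ] with σ hσ using hstate σ hσ

/-- A local flow of the geodesic spray in the chart at `x₁`, for times in `(-δ, δ)` and initial
states in `W`, with its derivative `A` in the initial state. -/
structure IsGeodesicFlow (x₁ : M) (δ : ℝ) (W : Set (E × E)) (Φ : E × E → ℝ → E × E)
    (A : E × E → ℝ → E × E →L[ℝ] E × E) : Prop where
  pos : 0 < δ
  isOpen : IsOpen W
  zero : ∀ z ∈ W, Φ z 0 = z
  mem_target : ∀ z ∈ W, ∀ t ∈ Ioo (-δ) δ, (Φ z t).1 ∈ (chartAt E x₁).target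
  hasDerivAt : ∀ z ∈ W, ∀ t ∈ Ioo (-δ) δ, HasDerivAt (Φ z) (spray x₁ (Φ z t)) t
  hasDerivAt_deriv : ∀ z ∈ W, ∀ t ∈ Ioo (-δ) δ,
    HasDerivAt (A z) ((fderiv ℝ (spray x₁) (Φ z t)).comp (A z t)) t
  hasFDerivAt : ∀ z ∈ W, ∀ t ∈ Ioo (-δ) δ, HasFDerivAt (fun z ↦ Φ z t) (A z t) z
  contDiffAt : ∀ z ∈ W, ∀ t ∈ Ioo (-δ) δ, ContDiffAt ℝ 1 (fun z ↦ Φ z t) z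

theorem exists_isGeodesicFlow {x₁ : M} {z₁ : E × E} (hz : z₁.1 ∈ (chartAt E x₁).target) :
    ∃ δ W Φ A, IsGeodesicFlow (E := E) x₁ δ W Φ A ∧ z₁ ∈ W := by
  have : CompleteSpace E := FiniteDimensional.complete ℝ E
  have hU : Prod.fst ⁻¹' (chartAt E x₁).target ∈ 𝓝 z₁ :=
    ((chartAt E x₁).open_target.preimage continuous_fst).mem_nhds hz
  obtain ⟨δ, hδ, W, hW, hzW, Φ, A, h⟩ := exists_local_flow
    ((contDiffAt_spray hz).of_le (by norm_cast : (2 : ℕ∞ω) ≤ ∞)) hU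
  refine ⟨δ, W, Φ, A, ⟨hδ, hW, fun z hz ↦ (h z hz).1,
    fun z hz t ht ↦ ((h z hz).2.2 t ht).1, fun z hz t ht ↦ ((h z hz).2.2 t ht).2.1,
    fun z hz t ht ↦ ((h z hz).2.2 t ht).2.2.1, fun z hz t ht ↦ ((h z hz).2.2 t ht).2.2.2.1,
    fun z hz t ht ↦ ?_⟩, hzW⟩
  exact contDiffAt_one_iff.2 ⟨fun z ↦ A z t, W, hW.mem_nhds hz,
    fun z' hz' ↦ ((h z' hz').2.2 t ht).2.2.2.2.continuousWithinAt,
    fun z' hz' ↦ ((h z' hz').2.2 t ht).2.2.2.1⟩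

/-- The geodesic through the state `z` of the chart at time `T`. -/
def IsGeodesicFlow.curve (x₁ : M) (Φ : E × E → ℝ → E × E) (z : E × E) (T t : ℝ) : M :=
  (chartAt E x₁).symm (Φ z (t - T)).1

theorem IsGeodesicFlow.solvesGeodesicEq_curve {x₁ : M} {δ : ℝ} {W : Set (E × E)}
    {Φ : E × E → ℝ → E × E} {A : E × E → ℝ → E × E →L[ℝ] E × E}
    (h : IsGeodesicFlow x₁ δ W Φ A) {z : E × E} (hz : z ∈ W) {T t : ℝ}
    (ht : t ∈ Ioo (T - δ) (T + δ)) :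
    SolvesGeodesicEq (E := E) x₁ (IsGeodesicFlow.curve x₁ Φ z T) t ∧
      chartState (E := E) x₁ (IsGeodesicFlow.curve x₁ Φ z T) t = Φ z (t - T) := by
  refine solvesGeodesicEq_of_hasDerivAt_spray (X := fun t ↦ Φ z (t - T)) isOpen_Ioo
    (fun τ hτ ↦ ?_) ht
  have hτ' : τ - T ∈ Ioo (-δ) δ := ⟨by linarith [hτ.1], by linarith [hτ.2]⟩
  exact ⟨h.mem_target z hz _ hτ', (h.hasDerivAt z hz _ hτ').comp_sub_const τ T⟩

/-- Two geodesics that agree at some common time can be glued. -/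
theorem GeodesicFrom.glue [T2Space M] {q : M} {v : E} {γ γ' : ℝ → M} {a b a' b' T : ℝ}
    (h : GeodesicFrom q v γ a b)
    (h' : ∀ t ∈ Ioo a' b', ∃ x₀ : M, SolvesGeodesicEq (E := E) x₀ γ' t) (hT : T ∈ Ioo a b)
    (hT' : T ∈ Ioo a' b') (heq : γ =ᶠ[𝓝 T] γ') :
    ∃ γ'' : ℝ → M, GeodesicFrom q v γ'' (min a a') (max b b') ∧
      ∀ t ∈ Ioo a' b', γ'' =ᶠ[𝓝 t] γ' := by
  classical
  have hagree : ∀ t ∈ Ioo a b, t ∈ Ioo a' b' → γ t = γ' t := by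
    intro t ht ht'
    have hs : IsPreconnected (Ioo a b ∩ Ioo a' b') := by
      rw [Ioo_inter_Ioo]; exact isPreconnected_Ioo
    exact (eventuallyEq_of_solvesGeodesicEq hs (fun t ht ↦ h.solves t ht.1)
      (fun t ht ↦ h' t ht.2) ⟨hT, hT'⟩ heq ⟨ht, ht'⟩).self_of_nhds
  -- The two curves agree where both intervals overlap, so this curve equals γ' on all of (a', b'),
  -- not only outside (a, b). As both intervals contain T, their union is an interval.
  set γ'' : ℝ → M := fun t ↦ if t ∈ Ioo a b then γ t else γ' t with hγ''
  have he : ∀ t ∈ Ioo a b, γ'' =ᶠ[𝓝 t] γ := fun t ht ↦ by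
    filter_upwards [isOpen_Ioo.mem_nhds ht] with τ hτ
    simp only [hγ'', if_pos hτ]
  have he' : ∀ t ∈ Ioo a' b', γ'' =ᶠ[𝓝 t] γ' := fun t ht ↦ by
    filter_upwards [isOpen_Ioo.mem_nhds ht] with τ hτ
    by_cases hm : τ ∈ Ioo a b
    · simp only [hγ'', if_pos hm, hagree τ hm hτ]
    · simp only [hγ'', if_neg hm]
  refine ⟨γ'', ⟨⟨min_lt_of_left_lt h.zero_mem.1, lt_max_of_lt_left h.zero_mem.2⟩, ?_, ?_, ?_⟩, he'⟩
  · intro t ht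
    have hcov : t ∈ Ioo a b ∨ t ∈ Ioo a' b' := by
      rcases lt_trichotomy t T with hlt | rfl | hgt
      · rcases min_lt_iff.1 ht.1 with h1 | h1
        · exact .inl ⟨h1, hlt.trans hT.2⟩
        · exact .inr ⟨h1, hlt.trans hT'.2⟩
      · exact .inl hT
      · rcases lt_max_iff.1 ht.2 with h1 | h1
        · exact .inl ⟨hT.1.trans hgt, h1⟩
        · exact .inr ⟨hT'.1.trans hgt, h1⟩
    rcases hcov with hm | hm
    · obtain ⟨x₀, hx₀⟩ := h.solves t hm
      exact ⟨x₀, hx₀.congr (he t hm)⟩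
    · obtain ⟨x₀, hx₀⟩ := h' t hm
      exact ⟨x₀, hx₀.congr (he' t hm)⟩
  · rw [(he 0 h.zero_mem).self_of_nhds, h.start]
  · rw [chartState_eq_of_eventuallyEq (he 0 h.zero_mem), h.chartState_zero]

/-- The geodesics from `q` with initial velocity near `v₀` exist up to time `T`, where their states
in the chart at `x₁` are a `C¹` function `G` of the initial velocity. -/
def IsGeodesicFamily (q : M) (v₀ : E) (x₁ : M) (T : ℝ) (G : E → E × E) : Prop :=
  ContDiffAt ℝ 1 G v₀ ∧ ∀ᶠ v in 𝓝 v₀, ∃ γ : ℝ → M, ∃ a b : ℝ, GeodesicFrom q v γ a b ∧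
    T ∈ Ioo a b ∧ γ T ∈ (chartAt E x₁).source ∧ chartState (E := E) x₁ γ T = G v

theorem IsGeodesicFamily.chartState_eq [T2Space M] {q : M} {v₀ : E} {x₁ : M} {T : ℝ}
    {G : E → E × E} (h : IsGeodesicFamily q v₀ x₁ T G) {γ₀ : ℝ → M} {a b : ℝ}
    (h₀ : GeodesicFrom q v₀ γ₀ a b) (hT : T ∈ Ioo a b) :
    γ₀ T ∈ (chartAt E x₁).source ∧ chartState (E := E) x₁ γ₀ T = G v₀ := by
  obtain ⟨γ, a', b', hγ, hT', hm, hs⟩ := h.2.self_of_nhds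
  have he := h₀.eventuallyEq hγ hT hT'
  exact ⟨he.self_of_nhds ▸ hm, (chartState_eq_of_eventuallyEq he).trans hs⟩

theorem IsGeodesicFamily.change_chart [T2Space M] {q : M} {v₀ : E} {x₁ x₂ : M} {T : ℝ}
    {G : E → E × E} (h : IsGeodesicFamily q v₀ x₁ T G) {γ₀ : ℝ → M} {a b : ℝ}
    (h₀ : GeodesicFrom q v₀ γ₀ a b) (hT : T ∈ Ioo a b) (h₂ : γ₀ T ∈ (chartAt E x₂).source) :
    IsGeodesicFamily q v₀ x₂ T (stateTransition x₁ x₂ ∘ G) := by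
  obtain ⟨h₁, hG⟩ := h.chartState_eq h₀ hT
  have hG1 : G v₀ = (chartAt E x₁ (γ₀ T), (G v₀).2) := Prod.ext (congrArg Prod.fst hG).symm rfl
  refine ⟨ContDiffAt.comp v₀ (hG1 ▸ contDiffAt_stateTransition h₁ h₂) h.1, ?_⟩
  have hcont : ContinuousAt (fun v ↦ (chartAt E x₁).symm (G v).1) v₀ := by
    refine ContinuousAt.comp (f := fun v ↦ (G v).1) ((chartAt E x₁).continuousAt_symm ?_)
      (continuousAt_fst.comp h.1.continuousAt)
    rw [hG1]
    exact (chartAt E x₁).map_source h₁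
  have hmem : ∀ᶠ v in 𝓝 v₀, (chartAt E x₁).symm (G v).1 ∈ (chartAt E x₂).source := by
    refine hcont.eventually_mem ((chartAt E x₂).open_source.mem_nhds ?_)
    rw [hG1, (chartAt E x₁).left_inv h₁]
    exact h₂
  filter_upwards [h.2, hmem] with v ⟨γ, a', b', hγ, hTγ, hm, hs⟩ hv
  have hγT : (chartAt E x₁).symm (G v).1 = γ T := by
    rw [← hs]
    exact (chartAt E x₁).left_inv hm
  rw [hγT] at hv
  refine ⟨γ, a', b', hγ, hTγ, hv, ?_⟩
  rw [Function.comp_apply, ← hs]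
  exact (hγ.solvesGeodesicEq hTγ hm).chartState_eq hv

/-- A local flow transports families of geodesics. -/
theorem IsGeodesicFlow.isGeodesicFamily [T2Space M] {x₁ : M} {δ : ℝ} {W : Set (E × E)}
    {Φ : E × E → ℝ → E × E} {A : E × E → ℝ → E × E →L[ℝ] E × E}
    (h : IsGeodesicFlow x₁ δ W Φ A) {q : M} {v₀ : E} {T T' : ℝ} {G : E → E × E}
    (hG : IsGeodesicFamily q v₀ x₁ T G) (hW : G v₀ ∈ W) (hT' : T' ∈ Ioo (T - δ) (T + δ)) :
    IsGeodesicFamily q v₀ x₁ T' (fun v ↦ Φ (G v) (T' - T)) := by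
  have hτ : T' - T ∈ Ioo (-δ) δ := ⟨by linarith [hT'.1], by linarith [hT'.2]⟩
  have hTT : T ∈ Ioo (T - δ) (T + δ) := ⟨by linarith [h.pos], by linarith [h.pos]⟩
  refine ⟨ContDiffAt.comp v₀ (h.contDiffAt _ hW _ hτ) hG.1, ?_⟩
  filter_upwards [hG.2, hG.1.continuousAt.eventually_mem (h.isOpen.mem_nhds hW)]
    with v ⟨γ, a, b, hγ, hTγ, hm, hs⟩ hv
  have hcurve := fun t (ht : t ∈ Ioo (T - δ) (T + δ)) ↦ h.solvesGeodesicEq_curve hv ht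
  have heq : γ =ᶠ[𝓝 T] IsGeodesicFlow.curve x₁ Φ (G v) T := by
    refine (hγ.solvesGeodesicEq hTγ hm).eventuallyEq (hcurve T hTT).1 ?_
    rw [hs, (hcurve T hTT).2, sub_self, h.zero _ hv]
  obtain ⟨γ'', hγ'', he⟩ := hγ.glue (fun t ht ↦ ⟨x₁, (hcurve t ht).1⟩) hTγ hTT heq
  have heT := he T' hT'
  exact ⟨γ'', _, _, hγ'', ⟨min_lt_of_right_lt hT'.1, lt_max_of_lt_right hT'.2⟩,
    heT.self_of_nhds ▸ (hcurve T' hT').1.self_of_nhds.1,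
    (chartState_eq_of_eventuallyEq heT).trans (hcurve T' hT').2⟩

/-- A flow box around the state of (q, v₀) provides short geodesics for all nearby velocities. This
is the starting point of the continuation in time. -/
theorem exists_isGeodesicFamily_zero [T2Space M] (q : M) (v₀ : E) :
    IsGeodesicFamily q v₀ q 0 (fun v ↦ (chartAt E q q, v)) := by
  have hq : ((chartAt E q q, v₀) : E × E).1 ∈ (chartAt E q).target := mem_chart_target E q
  obtain ⟨δ, W, Φ, A, h, hW⟩ := exists_isGeodesicFlow hq
  have hcont : ContDiffAt ℝ 1 (fun v : E ↦ ((chartAt E q q, v) : E × E)) v₀ :=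
    contDiffAt_const.prodMk contDiffAt_id
  refine ⟨hcont, ?_⟩
  filter_upwards [hcont.continuousAt.eventually_mem (h.isOpen.mem_nhds hW)] with v hv
  have h0 : (0 : ℝ) ∈ Ioo (0 - δ) (0 + δ) := ⟨by linarith [h.pos], by linarith [h.pos]⟩
  have hst : IsGeodesicFlow.curve q Φ (chartAt E q q, v) 0 0 = q := by
    rw [IsGeodesicFlow.curve, sub_zero, h.zero _ hv]
    exact (chartAt E q).left_inv (mem_chart_source E q)
  have hcs : chartState (E := E) q (IsGeodesicFlow.curve q Φ (chartAt E q q, v) 0) 0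
      = (chartAt E q q, v) := by
    rw [(h.solvesGeodesicEq_curve hv h0).2, sub_zero, h.zero _ hv]
  refine ⟨IsGeodesicFlow.curve q Φ (chartAt E q q, v) 0, 0 - δ, 0 + δ,
    ⟨h0, fun t ht ↦ ⟨q, (h.solvesGeodesicEq_curve hv ht).1⟩, hst, hcs⟩, h0, ?_, hcs⟩
  rw [hst]
  exact mem_chart_source E q

/-- Smooth dependence of geodesics on the initial velocity. -/
theorem GeodesicFrom.exists_isGeodesicFamily [T2Space M] {q : M} {v₀ : E} {γ₀ : ℝ → M} {a b : ℝ}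
    (h₀ : GeodesicFrom q v₀ γ₀ a b) {T : ℝ} (hT : T ∈ Ioo a b) {x₁ : M}
    (h₁ : γ₀ T ∈ (chartAt E x₁).source) : ∃ G, IsGeodesicFamily q v₀ x₁ T G := by
  suffices hex : ∃ x G, IsGeodesicFamily q v₀ x T G by
    obtain ⟨x, G, hG⟩ := hex
    exact ⟨_, hG.change_chart h₀ hT h₁⟩
  refine (isPreconnected_Ioo.induction₂ (s := Ioo a b) (fun T T' ↦
    ((∃ x G, IsGeodesicFamily q v₀ x T G) ↔ ∃ x G, IsGeodesicFamily q v₀ x T' G)) ?_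
    (fun _ _ _ _ _ _ h1 h2 ↦ h1.trans h2) (fun _ _ _ _ h ↦ h.symm) h₀.zero_mem hT).1
    ⟨q, _, exists_isGeodesicFamily_zero q v₀⟩
  intro T₁ hT₁
  have hm : γ₀ T₁ ∈ (chartAt E (γ₀ T₁)).source := mem_chart_source E (γ₀ T₁)
  have hsol := h₀.solvesGeodesicEq hT₁ hm
  obtain ⟨δ, W, Φ, A, h, hW⟩ := exists_isGeodesicFlow
    (z₁ := chartState (E := E) (γ₀ T₁) γ₀ T₁) ((chartAt E (γ₀ T₁)).map_source hm)
  filter_upwards [nhdsWithin_le_nhds hsol, self_mem_nhdsWithin,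
    nhdsWithin_le_nhds (hsol.self_of_nhds.2.2.continuousAt.eventually_mem (h.isOpen.mem_nhds hW)),
    nhdsWithin_le_nhds (Ioo_mem_nhds (by linarith [h.pos] : T₁ - δ < T₁)
      (by linarith [h.pos] : T₁ < T₁ + δ))] with T' hT'm hT' hT'W hT'δ
  have key : ∀ S S', S ∈ Ioo a b → γ₀ S ∈ (chartAt E (γ₀ T₁)).source →
      chartState (E := E) (γ₀ T₁) γ₀ S ∈ W → S' ∈ Ioo (S - δ) (S + δ) →
      (∃ x G, IsGeodesicFamily q v₀ x S G) → ∃ x G, IsGeodesicFamily q v₀ x S' G := by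
    rintro S S' hS hSm hSW hS' ⟨x, G, hG⟩
    have hG' := hG.change_chart h₀ hS hSm
    exact ⟨_, _, h.isGeodesicFamily hG' ((hG'.chartState_eq h₀ hS).2 ▸ hSW) hS'⟩
  exact ⟨key T₁ T' hT₁ hm hW hT'δ, key T' T₁ hT' hT'm.1 hT'W
    ⟨by linarith [hT'δ.2], by linarith [hT'δ.1]⟩⟩

theorem IsGeodesicFamily.expMap_eq [T2Space M] {q : M} {v₀ : E} {x₁ : M} {T : ℝ} {G : E → E × E}
    (h : IsGeodesicFamily q v₀ x₁ T G) :
    ∀ᶠ v : TangentSpace 𝓘(ℝ, E) q in 𝓝 v₀, T • v ∈ expDomain q ∧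
      expMap q (T • v) ∈ (chartAt E x₁).source ∧ chartAt E x₁ (expMap q (T • v)) = (G v).1 := by
  refine h.2.mono ?_
  rintro v ⟨γ, a, b, hγ, hT, hm, hs⟩
  have := GeodesicFrom.expMap_smul (v := (v : TangentSpace 𝓘(ℝ, E) q)) hγ hT
  rw [this]
  exact ⟨GeodesicFrom.smul_mem_expDomain (v := (v : TangentSpace 𝓘(ℝ, E) q)) hγ hT, hm,
    congrArg Prod.fst hs⟩

end SmoothDependence

/-! ### The exponential map and its variation fields -/

section ExpMap

variable {E : Type*} [NormedAddCommGroup E] [NormedSpace ℝ E] [FiniteDimensional ℝ E]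
  {M : Type*} [TopologicalSpace M] [ChartedSpace E M] [IsManifold 𝓘(ℝ, E) ∞ M]
  [RiemannianBundle (fun x : M ↦ TangentSpace 𝓘(ℝ, E) x)]

/-- The exponential map at `q`, as a function on the model space `E` of `T_q M`. -/
def modelExp (q : M) (v : E) : M := expMap (E := E) q v

/-- The differential at `v₀` of `v ↦ Exp_q (t v)`, applied to `w`: the variation field of the
geodesics with initial velocity `v₀ + s w`. -/
def variationField (q : M) (v₀ w : E) (t : ℝ) : TangentSpace 𝓘(ℝ, E) (modelExp q (t • v₀)) :=
  mfderiv 𝓘(ℝ, E) 𝓘(ℝ, E) (fun v : E ↦ modelExp q (t • v)) v₀ w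

variable [IsContMDiffRiemannianBundle 𝓘(ℝ, E) ∞ E (fun x : M ↦ TangentSpace 𝓘(ℝ, E) x)]
  [T2Space M]

theorem GeodesicFrom.modelExp_smul {q : M} {v₀ : E} {γ₀ : ℝ → M} {a b : ℝ}
    (h₀ : GeodesicFrom q v₀ γ₀ a b) {T : ℝ} (hT : T ∈ Ioo a b) : modelExp q (T • v₀) = γ₀ T :=
  GeodesicFrom.expMap_smul (v := (v₀ : TangentSpace 𝓘(ℝ, E) q)) h₀ hT

theorem IsGeodesicFamily.modelExp_eq {q : M} {v₀ : E} {x₁ : M} {T : ℝ} {G : E → E × E}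
    (h : IsGeodesicFamily q v₀ x₁ T G) :
    ∀ᶠ v in 𝓝 v₀, modelExp q (T • v) ∈ (chartAt E x₁).source ∧
      chartAt E x₁ (modelExp q (T • v)) = (G v).1 :=
  h.expMap_eq.mono fun _ hv ↦ hv.2

/-- Any geodesic may be replaced by `t ↦ Exp_q (t v)`. -/
theorem GeodesicFrom.geodesicFrom_modelExp {q : M} {v₀ : E} {γ₀ : ℝ → M} {a b : ℝ}
    (h₀ : GeodesicFrom q v₀ γ₀ a b) : GeodesicFrom q v₀ (fun t ↦ modelExp q (t • v₀)) a b := by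
  have he : ∀ t ∈ Ioo a b, (fun t : ℝ ↦ modelExp q (t • v₀)) =ᶠ[𝓝 t] γ₀ := fun t ht ↦ by
    filter_upwards [isOpen_Ioo.mem_nhds ht] with τ hτ using h₀.modelExp_smul hτ
  refine ⟨h₀.zero_mem, fun t ht ↦ ?_, ?_, ?_⟩
  · obtain ⟨x₀, hx₀⟩ := h₀.solves t ht
    exact ⟨x₀, hx₀.congr (he t ht)⟩
  · exact (he 0 h₀.zero_mem).self_of_nhds.trans h₀.start
  · rw [chartState_eq_of_eventuallyEq (he 0 h₀.zero_mem), h₀.chartState_zero]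

theorem IsGeodesicFamily.contDiffAt_chart_modelExp {q : M} {v₀ : E} {x₁ : M} {T : ℝ}
    {G : E → E × E} (h : IsGeodesicFamily q v₀ x₁ T G) :
    ContDiffAt ℝ 1 (fun v ↦ chartAt E x₁ (modelExp q (T • v))) v₀ :=
  (contDiffAt_fst.comp v₀ h.1).congr_of_eventuallyEq (h.modelExp_eq.mono fun _ hv ↦ hv.2)

theorem IsGeodesicFamily.contMDiffAt_modelExp {q : M} {v₀ : E} {x₁ : M} {T : ℝ}
    {G : E → E × E} (h : IsGeodesicFamily q v₀ x₁ T G) :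
    ContMDiffAt 𝓘(ℝ, E) 𝓘(ℝ, E) 1 (fun v ↦ modelExp q (T • v)) v₀ := by
  have h1 := h.contDiffAt_chart_modelExp
  rw [← contMDiffAt_iff_contDiffAt] at h1
  have h2 : ContMDiffAt 𝓘(ℝ, E) 𝓘(ℝ, E) 1
      ((chartAt E x₁).symm ∘ fun v ↦ chartAt E x₁ (modelExp q (T • v))) v₀ :=
    ((contMDiffAt_chart_symm ((chartAt E x₁).map_source
      h.modelExp_eq.self_of_nhds.1)).of_le (by norm_cast)).comp v₀ h1
  refine h2.congr_of_eventuallyEq ?_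
  filter_upwards [h.modelExp_eq] with v hv
  exact ((chartAt E x₁).left_inv hv.1).symm

theorem GeodesicFrom.contMDiffAt_modelExp {q : M} {v₀ : E} {γ₀ : ℝ → M} {a b : ℝ}
    (h₀ : GeodesicFrom q v₀ γ₀ a b) {T : ℝ} (hT : T ∈ Ioo a b) :
    ContMDiffAt 𝓘(ℝ, E) 𝓘(ℝ, E) 1 (fun v ↦ modelExp q (T • v)) v₀ := by
  obtain ⟨G, hG⟩ := h₀.exists_isGeodesicFamily hT (mem_chart_source E (γ₀ T))
  exact hG.contMDiffAt_modelExp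

/-- The coordinates of the variation field are the derivatives of the coordinates of the
exponential map. -/
theorem GeodesicFrom.chartDeriv_variationField {q : M} {v₀ : E} {γ₀ : ℝ → M} {a b : ℝ}
    (h₀ : GeodesicFrom q v₀ γ₀ a b) {T : ℝ} (hT : T ∈ Ioo a b) {x₁ : M}
    (h₁ : modelExp q (T • v₀) ∈ (chartAt E x₁).source) (w : E) :
    chartDeriv (E := E) x₁ (modelExp q (T • v₀)) (variationField q v₀ w T) =
      fderiv ℝ (fun v ↦ chartAt E x₁ (modelExp q (T • v))) v₀ w := by
  have h := mfderiv_comp (I := 𝓘(ℝ, E)) (I' := 𝓘(ℝ, E)) (I'' := 𝓘(ℝ, E)) v₀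
    (g := chartAt E x₁) (f := fun v : E ↦ modelExp q (T • v)) (mdifferentiableAt_chart h₁)
    ((h₀.contMDiffAt_modelExp hT).mdifferentiableAt (by norm_num))
  rw [mfderiv_eq_fderiv] at h
  exact (DFunLike.congr_fun h w).symm

/-- In a chart, the variation field solves the linearized geodesic equation. -/
theorem GeodesicFrom.exists_linearized {q : M} {v₀ : E} {γ₀ : ℝ → M} {a b : ℝ}
    (h₀ : GeodesicFrom q v₀ γ₀ a b) {T : ℝ} (hT : T ∈ Ioo a b) {x₁ : M}
    (h₁ : γ₀ T ∈ (chartAt E x₁).source) (w : E) :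
    ∃ Y : ℝ → E × E, ∀ᶠ t in 𝓝 T,
      HasDerivAt Y (fderiv ℝ (spray x₁) (chartState (E := E) x₁ γ₀ t) (Y t)) t ∧
      chartDeriv (E := E) x₁ (modelExp q (t • v₀)) (variationField q v₀ w t) = (Y t).1 := by
  obtain ⟨G, hG⟩ := h₀.exists_isGeodesicFamily hT h₁
  obtain ⟨-, hGv⟩ := hG.chartState_eq h₀ hT
  obtain ⟨δ, W, Φ, A, h, hW⟩ := exists_isGeodesicFlow
    (z₁ := chartState (E := E) x₁ γ₀ T) ((chartAt E x₁).map_source h₁)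
  rw [hGv] at hW
  -- The state at time t of the geodesic with velocity v is Φ (G v) (t - T); the witness is its
  -- derivative at v₀ in the direction w, by the chain rule.
  refine ⟨fun t ↦ A (G v₀) (t - T) (fderiv ℝ G v₀ w), ?_⟩
  filter_upwards [Ioo_mem_nhds (by linarith [h.pos] : T - δ < T)
    (by linarith [h.pos] : T < T + δ), isOpen_Ioo.mem_nhds hT] with t ht htab
  have hτ : t - T ∈ Ioo (-δ) δ := ⟨by linarith [ht.1], by linarith [ht.2]⟩
  have hGt := h.isGeodesicFamily hG hW ht
  obtain ⟨hm, hst⟩ := hGt.chartState_eq h₀ htab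
  constructor
  · rw [hst]
    have h1 := (h.hasDerivAt_deriv _ hW _ hτ).comp_sub_const t T
    have h2 := h1.clm_apply (hasDerivAt_const t (fderiv ℝ G v₀ w))
    simpa using h2
  · rw [h₀.chartDeriv_variationField htab (by rwa [h₀.modelExp_smul htab])]
    have he : (fun v ↦ chartAt E x₁ (modelExp q (t • v))) =ᶠ[𝓝 v₀]
        fun v ↦ (Φ (G v) (t - T)).1 := hGt.modelExp_eq.mono fun _ hv ↦ hv.2
    have hd : HasFDerivAt (fun v ↦ (Φ (G v) (t - T)).1)
        ((ContinuousLinearMap.fst ℝ E E).comp ((A (G v₀) (t - T)).comp (fderiv ℝ G v₀))) v₀ :=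
      (ContinuousLinearMap.fst ℝ E E).hasFDerivAt.comp v₀
        (HasFDerivAt.comp (f := G) v₀ (h.hasFDerivAt _ hW _ hτ)
          (hG.1.differentiableAt (by norm_num)).hasFDerivAt)
    rw [he.fderiv_eq, hd.fderiv]
    rfl

end ExpMap

/-! ### The linearized geodesic equation is the Jacobi equation -/

section Jacobi

variable {E : Type*} [NormedAddCommGroup E] [NormedSpace ℝ E] [FiniteDimensional ℝ E]
  {M : Type*} [TopologicalSpace M] [ChartedSpace E M] [IsManifold 𝓘(ℝ, E) ∞ M]
  [RiemannianBundle (fun x : M ↦ TangentSpace 𝓘(ℝ, E) x)]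
  [IsContMDiffRiemannianBundle 𝓘(ℝ, E) ∞ E (fun x : M ↦ TangentSpace 𝓘(ℝ, E) x)]

theorem trivializationAt_snd {x₁ m : M} (hm : m ∈ (chartAt E x₁).source)
    (v : TangentSpace 𝓘(ℝ, E) m) :
    (trivializationAt E (TangentSpace 𝓘(ℝ, E)) x₁ (⟨m, v⟩ : TangentBundle 𝓘(ℝ, E) M)).2 =
      chartDeriv (E := E) x₁ m v := by
  have : IsManifold 𝓘(ℝ, E) 1 M := .of_le (n := ∞) (by simp)
  rw [chartDeriv, mfderiv_chartAt_eq_tangentCoordChange hm]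
  rfl

theorem fderiv_christoffelForm_symm {x₀ : M} {y : E} (hy : y ∈ (chartAt E x₀).target)
    (z u w : E) :
    fderiv ℝ (christoffelForm (metricInChart (E := E) x₀)) y z u w =
      fderiv ℝ (christoffelForm (metricInChart (E := E) x₀)) y z w u := by
  have hB : DifferentiableAt ℝ (christoffelForm (metricInChart (E := E) x₀)) y :=
    (contDiffAt_christoffelForm_metricInChart hy).differentiableAt (by simp)
  have h : ∀ u w : E, HasFDerivAt
      (fun y' ↦ christoffelForm (metricInChart (E := E) x₀) y' u w)
      (((ContinuousLinearMap.apply ℝ E w).comp (ContinuousLinearMap.apply ℝ (E →L[ℝ] E) u)).comp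
        (fderiv ℝ (christoffelForm (metricInChart (E := E) x₀)) y)) y := fun u w ↦
    (((ContinuousLinearMap.apply ℝ E w).comp
      (ContinuousLinearMap.apply ℝ (E →L[ℝ] E) u)).hasFDerivAt).comp y hB.hasFDerivAt
  have he : (fun y' ↦ christoffelForm (metricInChart (E := E) x₀) y' u w) =ᶠ[𝓝 y]
      fun y' ↦ christoffelForm (metricInChart (E := E) x₀) y' w u := by
    filter_upwards [(chartAt E x₀).open_target.mem_nhds hy] with y' hy'
    exact christoffel_symm hy' u w
  exact DFunLike.congr_fun (((h u w).congr_of_eventuallyEq he.symm).unique (h w u)) z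

/-- Differentiating Γ with frozen arguments amounts to evaluating the derivative of the
bilinear-map-valued `christoffelForm`, the form in which it occurs in the linearized spray. -/
theorem curvature_eq (x : M) (u w z : E) :
    (curvature (E := E) x u w z : E) =
      fderiv ℝ (christoffelForm (metricInChart (E := E) x)) (chartAt E x x) u w z
      - fderiv ℝ (christoffelForm (metricInChart (E := E) x)) (chartAt E x x) w u z
      + christoffel x (chartAt E x x) u (christoffel x (chartAt E x x) w z)
      - christoffel x (chartAt E x x) w (christoffel x (chartAt E x x) u z) := by
  have hB : DifferentiableAt ℝ (christoffelForm (metricInChart (E := E) x)) (chartAt E x x) :=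
    (contDiffAt_christoffelForm_metricInChart (mem_chart_target E x)).differentiableAt (by simp)
  have h : ∀ u w : E, HasFDerivAt
      (fun y' ↦ christoffel x y' u w)
      (((ContinuousLinearMap.apply ℝ E w).comp (ContinuousLinearMap.apply ℝ (E →L[ℝ] E) u)).comp
        (fderiv ℝ (christoffelForm (metricInChart (E := E) x)) (chartAt E x x)))
        (chartAt E x x) := fun u w ↦
    (((ContinuousLinearMap.apply ℝ E w).comp
      (ContinuousLinearMap.apply ℝ (E →L[ℝ] E) u)).hasFDerivAt).comp _ hB.hasFDerivAt
  have hval : (curvature (E := E) x u w z : E) =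
      fderiv ℝ (fun y' ↦ christoffel x y' w z) (chartAt E x x) u
      - fderiv ℝ (fun y' ↦ christoffel x y' u z) (chartAt E x x) w
      + christoffel x (chartAt E x x) u (christoffel x (chartAt E x x) w z)
      - christoffel x (chartAt E x x) w (christoffel x (chartAt E x x) u z) := rfl
  rw [hval, (h w z).fderiv, (h u z).fderiv]
  rfl

/-- A vector field along a geodesic whose coordinates solve the linearized geodesic equation near
time `t` satisfies the Jacobi equation at time `t`. -/
theorem jacobi_equation_of_linearized {c : ℝ → M} {J : ∀ t, TangentSpace 𝓘(ℝ, E) (c t)} {t : ℝ}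
    (hc : SolvesGeodesicEq (E := E) (c t) c t) {Y : ℝ → E × E}
    (hY : ∀ᶠ τ in 𝓝 t,
      HasDerivAt Y (fderiv ℝ (spray (c t)) (chartState (E := E) (c t) c τ) (Y τ)) τ ∧
      chartDeriv (E := E) (c t) (c τ) (J τ) = (Y τ).1) :
    covDerivAlong c (covDerivAlong c J) t
      + curvature (c t) (J t) (velocity c t) (velocity c t) = 0 := by
  have hmt : c t ∈ (chartAt E (c t)).source := mem_chart_source E (c t)
  have hy : chartAt E (c t) (c t) ∈ (chartAt E (c t)).target := mem_chart_target E (c t)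
  let B : E → E →L[ℝ] E →L[ℝ] E := christoffelForm (metricInChart (E := E) (c t))
  let X : ℝ → E × E := chartState (E := E) (c t) c
  -- The linearized system contains Y₁' = Y₂, so D_t J has coordinates Y₂ + Γ(X₂, Y₁). This holds on
  -- a neighbourhood of t, so it can be differentiated again.
  have hinner : ∀ᶠ τ in 𝓝 t, chartDeriv (E := E) (c t) (c τ) (covDerivAlong c J τ) =
      (Y τ).2 + B (X τ).1 (X τ).2 (Y τ).1 := by
    filter_upwards [hc, hY, eventually_eventually_nhds.2 hY] with τ h1 h2 h3
    have hd : HasDerivAt (fun σ ↦ chartDeriv (E := E) (c t) (c σ) (J σ)) (Y τ).2 τ := by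
      have hfst := hasDerivAt_fst h2.1
      rw [fderiv_spray ((chartAt E (c t)).map_source h1.1)] at hfst
      exact hfst.congr_of_eventuallyEq (h3.mono fun σ hσ ↦ hσ.2)
    have := chartDeriv_covDerivAlong h1.1 h1.2.1 (hasDerivAt_fst h1.2.2) hd
    rw [h2.2] at this
    exact this
  obtain ⟨-, hcont, hXd⟩ := hc.self_of_nhds
  obtain ⟨hYd, hJt⟩ := hY.self_of_nhds
  rw [fderiv_spray hy] at hYd
  have hX₁ : HasDerivAt (fun τ ↦ (X τ).1) (X t).2 t := hasDerivAt_fst hXd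
  have hX₂ : HasDerivAt (fun τ ↦ (X τ).2) (-B (X t).1 (X t).2 (X t).2) t := hasDerivAt_snd hXd
  have hY₁ : HasDerivAt (fun τ ↦ (Y τ).1) (Y t).2 t := hasDerivAt_fst hYd
  have hY₂ : HasDerivAt (fun τ ↦ (Y τ).2) (-(fderiv ℝ B (X t).1 (Y t).1 (X t).2 (X t).2
      + B (X t).1 (Y t).2 (X t).2 + B (X t).1 (X t).2 (Y t).2)) t := hasDerivAt_snd hYd
  have hBf : HasFDerivAt B (fderiv ℝ B (X t).1) (X t).1 :=
    ((contDiffAt_christoffelForm_metricInChart hy).differentiableAt (by simp)).hasFDerivAt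
  have hBd : HasDerivAt (fun τ ↦ B (X τ).1) (fderiv ℝ B (X t).1 (X t).2) t :=
    HasFDerivAt.comp_hasDerivAt (f := fun τ ↦ (X τ).1) (l := B) t hBf hX₁
  have hDd := hY₂.add ((hBd.clm_apply hX₂).clm_apply hY₁)
  have houter := chartDeriv_covDerivAlong (V := covDerivAlong c J) hmt hcont hX₁
    (hDd.congr_of_eventuallyEq hinner)
  rw [hinner.self_of_nhds, chartDeriv_self] at houter
  rw [chartDeriv_self] at hJt
  have hvel : (velocity (E := E) c t : E) = (X t).2 := by
    have := chartDeriv_velocity hmt (hc.contMDiffAt.mdifferentiableAt (by norm_num))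
    rw [chartDeriv_self] at this
    exact this
  have hcurv := curvature_eq (c t) (Y t).1 (X t).2 (X t).2
  have hsB : ∀ u w, B (X t).1 u w = B (X t).1 w u := christoffel_symm hy
  have hsD : ∀ z u w, fderiv ℝ B (X t).1 z u w = fderiv ℝ B (X t).1 z w u :=
    fderiv_christoffelForm_symm hy
  have hJt' : (J t : E) = (Y t).1 := hJt
  have hout' : (covDerivAlong c (covDerivAlong c J) t : E) = _ := houter
  have hgoal : (covDerivAlong c (covDerivAlong c J) t : E)
      + (curvature (E := E) (c t) (J t) (velocity c t) (velocity c t) : E) = 0 := by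
    rw [hout', hvel, hJt', hcurv]
    change (-(fderiv ℝ B (X t).1 (Y t).1 (X t).2 (X t).2
        + B (X t).1 (Y t).2 (X t).2 + B (X t).1 (X t).2 (Y t).2)
      + ((fderiv ℝ B (X t).1 (X t).2 (X t).2 + B (X t).1 (-B (X t).1 (X t).2 (X t).2)) (Y t).1
        + B (X t).1 (X t).2 (Y t).2)
      + B (X t).1 (X t).2 ((Y t).2 + B (X t).1 (X t).2 (Y t).1))
      + (fderiv ℝ B (X t).1 (Y t).1 (X t).2 (X t).2
      - fderiv ℝ B (X t).1 (X t).2 (Y t).1 (X t).2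
      + B (X t).1 (Y t).1 (B (X t).1 (X t).2 (X t).2)
      - B (X t).1 (X t).2 (B (X t).1 (Y t).1 (X t).2)) = 0
    -- Once Γ and its derivatives are symmetrized in their lower arguments, all terms cancel.
    rw [hsB (Y t).1 (B (X t).1 (X t).2 (X t).2), hsB (Y t).1 (X t).2, hsB (Y t).2 (X t).2,
      hsD (X t).2 (Y t).1 (X t).2]
    simp only [add_apply, map_add, map_neg, neg_apply]
    abel
  exact hgoal

end Jacobi

/-! ### Nonconjugacy, invertibility of the differential of the exponential map, and the logarithm -/

section LogMap

variable {E : Type*} [NormedAddCommGroup E] [NormedSpace ℝ E] [FiniteDimensional ℝ E]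
  {M : Type*} [TopologicalSpace M] [T2Space M] [ChartedSpace E M] [IsManifold 𝓘(ℝ, E) ∞ M]
  [RiemannianBundle (fun x : M ↦ TangentSpace 𝓘(ℝ, E) x)]
  [IsContMDiffRiemannianBundle 𝓘(ℝ, E) ∞ E (fun x : M ↦ TangentSpace 𝓘(ℝ, E) x)]

/-- A solution of the linearized geodesic equation is of class `C¹`. -/
theorem contDiffAt_of_linearized {x₁ : M} {c : ℝ → M} {Y : ℝ → E × E} {t : ℝ}
    (hc : SolvesGeodesicEq (E := E) x₁ c t)
    (hY : ∀ᶠ τ in 𝓝 t, HasDerivAt Y (fderiv ℝ (spray x₁) (chartState (E := E) x₁ c τ) (Y τ)) τ) :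
    ContDiffAt ℝ 2 (fun τ ↦ (Y τ).1) t := by
  obtain ⟨u, hu, huo, htu⟩ := eventually_nhds_iff.1 (hc.and hY)
  have hst : ∀ τ ∈ u, HasDerivAt Y (fderiv ℝ (spray x₁) (chartState (E := E) x₁ c τ) (Y τ)) τ :=
    fun τ hτ ↦ (hu τ hτ).2
  have h1 : ContDiffOn ℝ 1 Y u := by
    rw [show (1 : ℕ∞ω) = 0 + 1 by norm_num, contDiffOn_succ_iff_deriv_of_isOpen huo]
    refine ⟨fun τ hτ ↦ (hst τ hτ).differentiableAt.differentiableWithinAt, by simp, ?_⟩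
    rw [contDiffOn_zero]
    refine ContinuousOn.congr
      (f := fun τ ↦ fderiv ℝ (spray (E := E) x₁) (chartState x₁ c τ) (Y τ)) ?_
      fun τ hτ ↦ (hst τ hτ).deriv
    intro τ hτ
    have hsp : ContinuousAt (fderiv ℝ (spray (E := E) x₁)) (chartState x₁ c τ) :=
      ((contDiffAt_spray (x₀ := x₁) (z := chartState (E := E) x₁ c τ)
        ((chartAt E x₁).map_source (hu τ hτ).1.1)).fderiv_right (m := 0)
        (by simp)).continuousAt
    exact ((hsp.comp (hu τ hτ).1.2.2.continuousAt).clm_apply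
      (hst τ hτ).continuousAt).continuousWithinAt
  -- The derivative of the first component is the second, so one order is gained. Variation fields
  -- are thus C² in time although the flow is only shown to be C¹ in the initial state.
  have h2 : ContDiffOn ℝ 2 (fun τ ↦ (Y τ).1) u := by
    rw [show (2 : ℕ∞ω) = 1 + 1 by norm_num, contDiffOn_succ_iff_deriv_of_isOpen huo]
    refine ⟨fun τ hτ ↦ (hasDerivAt_fst (hst τ hτ)).differentiableAt.differentiableWithinAt,
      by simp, h1.snd.congr fun τ hτ ↦ ?_⟩
    rw [(hasDerivAt_fst (hst τ hτ)).deriv,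
      fderiv_spray ((chartAt E x₁).map_source (hu τ hτ).1.1)]
  exact h2.contDiffAt (huo.mem_nhds htu)

/-- Variation fields of families of geodesics from `q` are Jacobi fields. -/
theorem GeodesicFrom.isJacobiFieldOn_variationField {q : M} {v₀ : E} {γ₀ : ℝ → M} {a b : ℝ}
    (h₀ : GeodesicFrom q v₀ γ₀ a b) (w : E) :
    IsJacobiFieldOn (fun t ↦ modelExp q (t • v₀)) (variationField q v₀ w) (Ioo a b) := by
  have : IsManifold 𝓘(ℝ, E) 1 M := .of_le (n := ∞) (by simp)
  have hc := h₀.geodesicFrom_modelExp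
  have key : ∀ t ∈ Ioo a b, ∃ Y : ℝ → E × E, ∀ᶠ τ in 𝓝 t,
      HasDerivAt Y (fderiv ℝ (spray (modelExp q (t • v₀)))
        (chartState (E := E) (modelExp q (t • v₀)) (fun t ↦ modelExp q (t • v₀)) τ) (Y τ)) τ ∧
      chartDeriv (E := E) (modelExp q (t • v₀)) (modelExp q (τ • v₀))
        (variationField q v₀ w τ) = (Y τ).1 := fun t ht ↦
    hc.exists_linearized ht (mem_chart_source E _) w
  refine ⟨fun t ht ↦ ?_, fun t ht ↦ ?_⟩
  · obtain ⟨Y, hY⟩ := key t ht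
    have hsol : SolvesGeodesicEq (E := E) (modelExp q (t • v₀)) (fun t ↦ modelExp q (t • v₀)) t :=
      hc.solvesGeodesicEq ht (mem_chart_source E _)
    refine ContMDiffAt.contMDiffWithinAt (Bundle.contMDiffAt_totalSpace.2
      ⟨hsol.contMDiffAt, ?_⟩)
    rw [contMDiffAt_iff_contDiffAt]
    refine (contDiffAt_of_linearized hsol (hY.mono fun _ h ↦ h.1)).congr_of_eventuallyEq ?_
    filter_upwards [hsol, hY] with τ h1 h2
    exact (trivializationAt_snd h1.1 _).trans h2.2
  · obtain ⟨Y, hY⟩ := key t ht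
    exact jacobi_equation_of_linearized (c := fun t ↦ modelExp q (t • v₀))
      (hc.solvesGeodesicEq ht (mem_chart_source E _)) hY

/-- The domain of `Exp_q`, as a subset of the model space `E` of `T_q M`. -/
def modelExpDomain (q : M) : Set E := expDomain (E := E) q

/-- The logarithm at `q`, with values in the model space `E` of `T_q M`. -/
def modelLog (q : M) (D : Set E) : M → E := logMap (E := E) q D

/-- The dependence on the initial velocity at time T = 1. One derivative is enough for the inverse
function theorem and for the interpolating curve. -/
theorem contMDiffAt_modelExp {q : M} {v : E}
    (hv : v ∈ modelExpDomain q) :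
    ContMDiffAt 𝓘(ℝ, E) 𝓘(ℝ, E) 1 (modelExp (E := E) q) v := by
  obtain ⟨γ, ε, hε, h⟩ := exists_geodesicFrom_of_mem_expDomain hv
  have := h.contMDiffAt_modelExp (T := 1) ⟨by linarith, by linarith⟩
  simpa only [one_smul] using this

theorem contDiffAt_chart_modelExp {q : M} {v : E}
    (hv : v ∈ modelExpDomain q) {x₁ : M}
    (h₁ : modelExp q v ∈ (chartAt E x₁).source) :
    ContDiffAt ℝ 1 (fun v ↦ chartAt E x₁ (modelExp q v)) v := by
  rw [← contMDiffAt_iff_contDiffAt]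
  exact ((contMDiffAt_chart h₁).of_le (by norm_cast)).comp v (contMDiffAt_modelExp hv)

theorem zero_mem_modelExpDomain (q : M) : (0 : E) ∈ modelExpDomain q := by
  obtain ⟨γ, a, b, h, h0, -⟩ := (exists_isGeodesicFamily_zero q (0 : E)).2.self_of_nhds
  have := GeodesicFrom.smul_mem_expDomain (v := (0 : TangentSpace 𝓘(ℝ, E) q)) h h0
  rw [zero_smul] at this
  exact this

theorem modelExp_zero (q : M) : modelExp q (0 : E) = q := by
  obtain ⟨γ, a, b, h, h0, -⟩ := (exists_isGeodesicFamily_zero q (0 : E)).2.self_of_nhds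
  have := h.modelExp_smul h0
  rwa [zero_smul, h.start] at this

/-- The differential of the exponential map at the origin is the identity. -/
theorem fderiv_chart_modelExp_zero (q : M) (v : E) :
    fderiv ℝ (fun v ↦ chartAt E q (modelExp q v)) (0 : E) v = v := by
  obtain ⟨γ, a, b, h, h0, -⟩ := (exists_isGeodesicFamily_zero q v).2.self_of_nhds
  have hd : HasFDerivAt (fun v ↦ chartAt E q (modelExp q v))
      (fderiv ℝ (fun v ↦ chartAt E q (modelExp q v)) (0 : E)) ((0 : ℝ) • v) := by
    rw [zero_smul]
    exact ((contDiffAt_chart_modelExp (zero_mem_modelExpDomain q)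
      (by rw [modelExp_zero]; exact mem_chart_source E q)).differentiableAt
      (by norm_num)).hasFDerivAt
  have hs : HasDerivAt (fun t : ℝ ↦ t • v) v 0 := by
    simpa using (hasDerivAt_id (0 : ℝ)).smul_const v
  -- Along the ray t ↦ t v the exponential map is the geodesic with initial velocity v; the two
  -- derivatives at t = 0 are compared.
  have h1 := (hd.comp_hasDerivAt (0 : ℝ) hs).deriv
  have he : ((fun v ↦ chartAt E q (modelExp q v)) ∘ fun t : ℝ ↦ t • v) =ᶠ[𝓝 0]
      (chartAt E q ∘ γ) := by
    filter_upwards [isOpen_Ioo.mem_nhds h0] with t ht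
    simp only [Function.comp_apply, h.modelExp_smul ht]
  rw [he.deriv_eq] at h1
  exact h1.symm.trans (congrArg Prod.snd h.chartState_zero)

/-- A variation field with non-zero initial derivative does not vanish identically. -/
theorem exists_variationField_ne_zero {q : M} {v₀ w : E}
    (hv : v₀ ∈ modelExpDomain q) (hw : w ≠ 0) :
    ∃ t ∈ Icc (0 : ℝ) 1, variationField q v₀ w t ≠ 0 := by
  obtain ⟨γ, ε, hε, h⟩ := exists_geodesicFrom_of_mem_expDomain hv
  have hF0 : ContDiffAt ℝ 1 (fun v ↦ chartAt E q (modelExp q v)) (0 : E) :=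
    contDiffAt_chart_modelExp (zero_mem_modelExpDomain q)
      (by rw [modelExp_zero]; exact mem_chart_source E q)
  set F : E → E := fun v ↦ chartAt E q (modelExp q v) with hF
  have hray : Tendsto (fun t : ℝ ↦ t • v₀) (𝓝 0) (𝓝 0) := by
    have : Continuous fun t : ℝ ↦ t • v₀ := by fun_prop
    simpa using this.tendsto 0
  -- In coordinates J(t) = t d(Exp_q)_{t v₀} w. The differential is continuous and equals the
  -- identity at 0, so it does not kill w near 0; a small t > 0 will do.
  have hne : ∀ᶠ v in 𝓝 (0 : E), fderiv ℝ F v w ≠ 0 := by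
    have hcont : ContinuousAt (fun v ↦ fderiv ℝ F v w) 0 :=
      (hF0.fderiv_right (m := 0) (by norm_num)).continuousAt.clm_apply continuousAt_const
    refine hcont.eventually_ne ?_
    rw [hF, fderiv_chart_modelExp_zero]
    exact hw
  have hdiff : ∀ᶠ v in 𝓝 (0 : E), DifferentiableAt ℝ F v :=
    (hF0.eventually (by simp)).mono fun v hv ↦ hv.differentiableAt (by norm_num)
  have hsrc : ∀ᶠ v in 𝓝 (0 : E), modelExp q v ∈ (chartAt E q).source := by
    refine (contMDiffAt_modelExp (zero_mem_modelExpDomain q)).continuousAt.eventually_mem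
      ((chartAt E q).open_source.mem_nhds ?_)
    rw [modelExp_zero]
    exact mem_chart_source E q
  obtain ⟨t, ⟨⟨htne, htd, htm⟩, ht1⟩, ht0⟩ :=
    ((((hray.eventually (hne.and (hdiff.and hsrc))).and
      (Iio_mem_nhds one_pos)).filter_mono (nhdsWithin_le_nhds (s := Ioi (0 : ℝ)))).and
      self_mem_nhdsWithin).exists
  have ht0' : 0 < t := ht0
  have ht1' : t < 1 := ht1
  refine ⟨t, ⟨ht0'.le, ht1'.le⟩, fun hJ ↦ ?_⟩
  have hcoord := h.chartDeriv_variationField (T := t) ⟨by linarith, by linarith⟩ htm w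
  have hz : chartDeriv (E := E) q (modelExp q (t • v₀)) (variationField q v₀ w t) = 0 :=
    (congrArg (chartDeriv (E := E) q (modelExp q (t • v₀))) hJ).trans
      (map_zero (chartDeriv (E := E) q (modelExp q (t • v₀))))
  have hd : HasFDerivAt (fun v ↦ F (t • v))
      ((fderiv ℝ F (t • v₀)).comp (t • ContinuousLinearMap.id ℝ E)) v₀ :=
    HasFDerivAt.comp (f := fun v : E ↦ t • v) v₀ htd.hasFDerivAt
      ((hasFDerivAt_id v₀).const_smul t)
  have hval : fderiv ℝ (fun v ↦ F (t • v)) v₀ w = t • fderiv ℝ F (t • v₀) w := by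
    rw [hd.fderiv]
    simp
  rw [hz] at hcoord
  have : t • fderiv ℝ F (t • v₀) w = 0 := hval.symm.trans hcoord.symm
  exact (smul_ne_zero ht0'.ne' htne) this

/-- If the end points of `t ↦ Exp_q (t v)` are not conjugate, then the differential of `Exp_q` at
`v` is injective. -/
theorem injective_fderiv_chart_modelExp {q : M} {v₀ : E}
    (hv : v₀ ∈ modelExpDomain q) {x₁ : M}
    (h₁ : modelExp q v₀ ∈ (chartAt E x₁).source)
    (hconj : ¬ AreConjugateAlong E (fun t : ℝ ↦ modelExp q (t • v₀)) 0 1) :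
    Function.Injective (fderiv ℝ (fun v ↦ chartAt E x₁ (modelExp q v)) v₀) := by
  rw [injective_iff_map_eq_zero]
  intro w hw
  by_contra hne
  apply hconj
  obtain ⟨γ, ε, hε, h⟩ := exists_geodesicFrom_of_mem_expDomain hv
  -- For a kernel vector w the variation field vanishes at 0, where all the geodesics start from q,
  -- and at 1, where its coordinates are the differential of `Exp_q` applied to w.
  refine ⟨variationField q v₀ w, ε, hε, h.isJacobiFieldOn_variationField w, ?_, ?_,
    exists_variationField_ne_zero hv hne⟩
  · have hconst : (fun v : E ↦ modelExp q ((0 : ℝ) • v)) = fun _ ↦ modelExp (E := E) q 0 := by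
      funext v
      rw [zero_smul]
    have : mfderiv 𝓘(ℝ, E) 𝓘(ℝ, E) (fun v : E ↦ modelExp q ((0 : ℝ) • v)) v₀ = 0 := by
      rw [hconst]
      exact mfderiv_const
    exact DFunLike.congr_fun this w
  · have hm : modelExp q ((1 : ℝ) • v₀) ∈ (chartAt E x₁).source := by rwa [one_smul]
    have hcoord := h.chartDeriv_variationField (T := 1) ⟨by linarith, by linarith⟩ hm w
    simp only [one_smul] at hcoord
    rw [hw] at hcoord
    apply (chartDeriv_isInvertible hm).injective
    refine Eq.trans ?_ (map_zero (chartDeriv (E := E) x₁ (modelExp q ((1 : ℝ) • v₀)))).symm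
    simpa only [one_smul] using hcoord

/-- `Log_q` is differentiable at a point `p` that is not conjugate to `q`, and its differential is
inverse to the differential of `Exp_q`. -/
theorem mdifferentiableAt_modelLog {p q : M} {D : Set E} (hD : IsOpen D)
    (hDdom : D ⊆ modelExpDomain q) (hDinj : InjOn (modelExp q) D) (hpD : p ∈ modelExp q '' D)
    (hconj : ¬ AreConjugateAlong E (fun t : ℝ ↦ modelExp q (t • modelLog q D p)) 0 1) :
    MDifferentiableAt 𝓘(ℝ, E) 𝓘(ℝ, E) (modelLog q D) p ∧ ∃ L : E →L[ℝ] E,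
      mfderiv 𝓘(ℝ, E) 𝓘(ℝ, E) (modelLog q D) p = L ∧
      ∀ u : E, fderiv ℝ (fun v ↦ chartAt E p (modelExp q v)) (modelLog q D p) (L u) = u := by
  have : CompleteSpace E := FiniteDimensional.complete ℝ E
  obtain ⟨Δ, hΔ⟩ : ∃ Δ : E, Δ = modelLog q D p := ⟨_, rfl⟩
  have hΔD : Δ ∈ D := hΔ ▸ Function.invFunOn_mem hpD
  have hΔp : modelExp q Δ = p := hΔ ▸ Function.invFunOn_eq hpD
  have hps : p ∈ (chartAt E p).source := mem_chart_source E p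
  have hΔdom : Δ ∈ modelExpDomain q := hDdom hΔD
  have hinj : Function.Injective (fderiv ℝ (fun v ↦ chartAt E p (modelExp q v)) Δ) := by
    refine injective_fderiv_chart_modelExp hΔdom (hΔp ▸ hps) ?_
    rw [hΔ]
    exact hconj
  have hC := contDiffAt_chart_modelExp hΔdom (x₁ := p) (by rw [hΔp]; exact hps)
  obtain ⟨F, hF⟩ : ∃ F : E → E, F = fun v ↦ chartAt E p (modelExp q v) := ⟨_, rfl⟩
  rw [← hF] at hinj hC
  let F' : E ≃L[ℝ] E :=
    (LinearEquiv.ofInjectiveEndo (fderiv ℝ F Δ : E →ₗ[ℝ] E) hinj).toContinuousLinearEquiv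
  have hF' : (F' : E →L[ℝ] E) = fderiv ℝ F Δ := by ext; rfl
  have hstrict : HasStrictFDerivAt F (F' : E →L[ℝ] E) Δ := by
    rw [hF']
    exact hC.hasStrictFDerivAt (by norm_num)
  have hFΔ : F Δ = chartAt E p p := by simp only [hF, hΔp]
  obtain ⟨g, hg⟩ : ∃ g : E → E, g = hstrict.localInverse F F' Δ := ⟨_, rfl⟩
  have hgd : HasFDerivAt g (F'.symm : E →L[ℝ] E) (chartAt E p p) := by
    rw [hg, ← hFΔ]
    exact hstrict.to_localInverse.hasFDerivAt
  have hgΔ : g (chartAt E p p) = Δ := by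
    rw [hg, ← hFΔ]
    exact hstrict.localInverse_apply_image
  have hginv : ∀ᶠ y in 𝓝 (chartAt E p p), F (g y) = y := by
    rw [hg, ← hFΔ]
    exact hstrict.eventually_right_inverse
  have hgc : Tendsto g (𝓝 (chartAt E p p)) (𝓝 Δ) := by
    have := hgd.continuousAt.tendsto
    rwa [hgΔ] at this
  have hgD : ∀ᶠ y in 𝓝 (chartAt E p p), g y ∈ D := hgc.eventually_mem (hD.mem_nhds hΔD)
  have hgs : ∀ᶠ y in 𝓝 (chartAt E p p), modelExp q (g y) ∈ (chartAt E p).source := by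
    refine hgc.eventually ((contMDiffAt_modelExp hΔdom).continuousAt.eventually_mem
      ((chartAt E p).open_source.mem_nhds ?_))
    rw [hΔp]
    exact hps
  have hφ : Tendsto (chartAt E p) (𝓝 p) (𝓝 (chartAt E p p)) := (chartAt E p).continuousAt hps
  -- The local inverse g takes values in the open set D near the image of p, and injectivity of
  -- `Exp_q` on D leaves no other preimage there for `Log_q` to select.
  have hlog : modelLog q D =ᶠ[𝓝 p] g ∘ chartAt E p := by
    filter_upwards [hφ.eventually (hginv.and (hgD.and hgs)),
      (chartAt E p).open_source.mem_nhds hps] with m ⟨h1, h2, h3⟩ hm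
    have hexp : modelExp q (g (chartAt E p m)) = m := by
      rw [hF] at h1
      exact (chartAt E p).injOn h3 hm h1
    have hex : ∃ v ∈ D, modelExp q v = m := ⟨g (chartAt E p m), h2, hexp⟩
    exact hDinj (Function.invFunOn_mem hex) h2
      ((Function.invFunOn_eq hex).trans hexp.symm)
  have hgm : MDifferentiableAt 𝓘(ℝ, E) 𝓘(ℝ, E) g (chartAt E p p) :=
    hgd.differentiableAt.mdifferentiableAt
  have hcomp : MDifferentiableAt 𝓘(ℝ, E) 𝓘(ℝ, E) (g ∘ chartAt E p) p :=
    hgm.comp p (mdifferentiableAt_chart hps)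
  refine ⟨hcomp.congr_of_eventuallyEq hlog, F'.symm, ?_, fun u ↦ ?_⟩
  · have h1 := mfderiv_comp (I := 𝓘(ℝ, E)) (I' := 𝓘(ℝ, E)) (I'' := 𝓘(ℝ, E)) p hgm
      (mdifferentiableAt_chart hps)
    rw [mfderiv_eq_fderiv, hgd.fderiv] at h1
    have h2 := hlog.mfderiv_eq (I := 𝓘(ℝ, E)) (I' := 𝓘(ℝ, E))
    refine (h2.trans h1).trans ?_
    -- The chart at p has identity differential at p, so d(Log_q)_p is the inverse of `F'` itself.
    exact (congrArg (fun L : E →L[ℝ] E ↦ (F'.symm : E →L[ℝ] E).comp L) (chartDeriv_self p)).trans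
      (ContinuousLinearMap.comp_id _)
  · rw [← hF, ← hΔ, ← hF']
    exact F'.apply_symm_apply u

end LogMap

/-! ### Cubic Hermite interpolation in T_q M and its image under the exponential map -/

section Interpolation

theorem hasDerivAt_hermiteA0 (t₀ t₁ t : ℝ) : HasDerivAt (hermiteA0 t₀ t₁)
    (-(1 / (t₁ - t₀) ^ 2 * (2 * (t - t₀)))
      + 2 / (t₁ - t₀) ^ 3 * (2 * (t - t₀) * (t - t₁) + (t - t₀) ^ 2)) t := by
  have h₀ : HasDerivAt (fun t ↦ t - t₀) 1 t := (hasDerivAt_id t).sub_const t₀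
  have h₁ : HasDerivAt (fun t ↦ t - t₁) 1 t := (hasDerivAt_id t).sub_const t₁
  refine (((h₀.pow 2).const_mul (1 / (t₁ - t₀) ^ 2)).const_sub 1 |>.add
    (((h₀.pow 2).mul h₁).const_mul (2 / (t₁ - t₀) ^ 3))).congr_deriv ?_
  simp

theorem hasDerivAt_hermiteB0 (t₀ t₁ t : ℝ) : HasDerivAt (hermiteB0 t₀ t₁)
    (1 - 1 / (t₁ - t₀) * (2 * (t - t₀))
      + 1 / (t₁ - t₀) ^ 2 * (2 * (t - t₀) * (t - t₁) + (t - t₀) ^ 2)) t := by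
  have h₀ : HasDerivAt (fun t ↦ t - t₀) 1 t := (hasDerivAt_id t).sub_const t₀
  have h₁ : HasDerivAt (fun t ↦ t - t₁) 1 t := (hasDerivAt_id t).sub_const t₁
  refine ((h₀.sub ((h₀.pow 2).const_mul (1 / (t₁ - t₀)))).add
    (((h₀.pow 2).mul h₁).const_mul (1 / (t₁ - t₀) ^ 2))).congr_deriv ?_
  simp

theorem hasDerivAt_hermiteB1 (t₀ t₁ t : ℝ) : HasDerivAt (hermiteB1 t₀ t₁)
    (1 / (t₁ - t₀) ^ 2 * (2 * (t - t₀) * (t - t₁) + (t - t₀) ^ 2)) t := by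
  have h₀ : HasDerivAt (fun t ↦ t - t₀) 1 t := (hasDerivAt_id t).sub_const t₀
  have h₁ : HasDerivAt (fun t ↦ t - t₁) 1 t := (hasDerivAt_id t).sub_const t₁
  refine (((h₀.pow 2).mul h₁).const_mul (1 / (t₁ - t₀) ^ 2)).congr_deriv ?_
  simp

variable {E : Type*} [NormedAddCommGroup E] [NormedSpace ℝ E]

/-- The cubic Hermite interpolant with value `Δ` and slope `v` at `t₀`, and with value `0` and
slope `w` at `t₁`. -/
def hermiteInterpolant (t₀ t₁ : ℝ) (Δ v w : E) (t : ℝ) : E :=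
  hermiteA0 t₀ t₁ t • Δ + hermiteB0 t₀ t₁ t • v + hermiteB1 t₀ t₁ t • w

theorem contDiff_hermiteInterpolant (t₀ t₁ : ℝ) (Δ v w : E) {n : ℕ∞ω} :
    ContDiff ℝ n (hermiteInterpolant t₀ t₁ Δ v w) := by
  unfold hermiteInterpolant hermiteA0 hermiteB0 hermiteB1
  fun_prop

theorem hasDerivAt_hermiteInterpolant_left {t₀ t₁ : ℝ} (Δ v w : E) :
    HasDerivAt (hermiteInterpolant t₀ t₁ Δ v w) v t₀ := by
  refine ((((hasDerivAt_hermiteA0 t₀ t₁ t₀).smul_const Δ).add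
    ((hasDerivAt_hermiteB0 t₀ t₁ t₀).smul_const v)).add
    ((hasDerivAt_hermiteB1 t₀ t₁ t₀).smul_const w)).congr_deriv ?_
  simp

theorem hasDerivAt_hermiteInterpolant_right {t₀ t₁ : ℝ} (ht : t₀ < t₁) (Δ v w : E) :
    HasDerivAt (hermiteInterpolant t₀ t₁ Δ v w) w t₁ := by
  have hne : t₁ - t₀ ≠ 0 := (sub_pos.2 ht).ne'
  refine ((((hasDerivAt_hermiteA0 t₀ t₁ t₁).smul_const Δ).add
    ((hasDerivAt_hermiteB0 t₀ t₁ t₁).smul_const v)).add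
    ((hasDerivAt_hermiteB1 t₀ t₁ t₁).smul_const w)).congr_deriv ?_
  have hA : -(1 / (t₁ - t₀) ^ 2 * (2 * (t₁ - t₀)))
      + 2 / (t₁ - t₀) ^ 3 * (2 * (t₁ - t₀) * (t₁ - t₁) + (t₁ - t₀) ^ 2) = 0 := by
    rw [sub_self t₁]; field_simp; ring
  have hB : 1 - 1 / (t₁ - t₀) * (2 * (t₁ - t₀))
      + 1 / (t₁ - t₀) ^ 2 * (2 * (t₁ - t₀) * (t₁ - t₁) + (t₁ - t₀) ^ 2) = 0 := by
    rw [sub_self t₁]; field_simp; ring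
  have hC : 1 / (t₁ - t₀) ^ 2 * (2 * (t₁ - t₀) * (t₁ - t₁) + (t₁ - t₀) ^ 2) = 1 := by
    rw [sub_self t₁]; field_simp; ring
  rw [hA, hB, hC]
  simp

theorem hermiteInterpolant_left (t₀ t₁ : ℝ) (Δ v w : E) :
    hermiteInterpolant t₀ t₁ Δ v w t₀ = Δ := by
  simp [hermiteInterpolant, hermiteA0, hermiteB0, hermiteB1]

theorem hermiteInterpolant_right {t₀ t₁ : ℝ} (ht : t₀ < t₁) (Δ v w : E) :
    hermiteInterpolant t₀ t₁ Δ v w t₁ = 0 := by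
  have hne : t₁ - t₀ ≠ 0 := (sub_pos.2 ht).ne'
  have hA : hermiteA0 t₀ t₁ t₁ = 0 := by simp [hermiteA0]; field_simp; simp
  have hB : hermiteB0 t₀ t₁ t₁ = 0 := by simp [hermiteB0]; field_simp; simp
  have hC : hermiteB1 t₀ t₁ t₁ = 0 := by simp [hermiteB1]
  simp [hermiteInterpolant, hA, hB, hC]

variable [FiniteDimensional ℝ E]
  {M : Type*} [TopologicalSpace M] [T2Space M] [ChartedSpace E M] [IsManifold 𝓘(ℝ, E) ∞ M]
  [RiemannianBundle (fun x : M ↦ TangentSpace 𝓘(ℝ, E) x)]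
  [IsContMDiffRiemannianBundle 𝓘(ℝ, E) ∞ E (fun x : M ↦ TangentSpace 𝓘(ℝ, E) x)]

theorem contMDiffAt_modelExp_comp {q : M} {P : ℝ → E} {t : ℝ} (hP : ContDiff ℝ 1 P)
    (hdom : P t ∈ modelExpDomain q) :
    ContMDiffAt 𝓘(ℝ, ℝ) 𝓘(ℝ, E) 1 (fun τ ↦ modelExp q (P τ)) t :=
  ContMDiffAt.comp t (contMDiffAt_modelExp hdom) hP.contDiffAt.contMDiffAt

/-- The velocity at `t` of the image of a curve in `T_q M` under the exponential map. -/
theorem velocityWithin_modelExp_comp {q m : M} {P : ℝ → E} {t : ℝ} {P' : E} {s : Set ℝ}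
    (hs : UniqueDiffWithinAt ℝ s t) (hP : ContDiff ℝ 1 P) (hdom : P t ∈ modelExpDomain q)
    (hP' : HasDerivAt P P' t) (hm : modelExp q (P t) = m) {u : TangentSpace 𝓘(ℝ, E) m}
    (hu : fderiv ℝ (fun v ↦ chartAt E m (modelExp q v)) (P t) P' = u) :
    velocityWithin (fun τ ↦ modelExp q (P τ)) s t = (⟨m, u⟩ : TangentBundle 𝓘(ℝ, E) M) := by
  have hmd : MDifferentiableAt 𝓘(ℝ, ℝ) 𝓘(ℝ, E) (fun τ ↦ modelExp q (P τ)) t :=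
    (contMDiffAt_modelExp_comp hP hdom).mdifferentiableAt (by norm_num)
  have hms : modelExp q (P t) ∈ (chartAt E m).source := hm ▸ mem_chart_source E m
  -- P is defined on all of ℝ and `Exp_q` is C¹ at P t, so the one-sided velocity at an end point is
  -- a two-sided one.
  rw [velocityWithin, mfderivWithin_eq_mfderiv hs.uniqueMDiffWithinAt hmd]
  refine (mk_velocity_eq_iff hmd).2 ⟨hm, Prod.ext (congrArg (chartAt E m) hm) ?_⟩
  have hd := ((contDiffAt_chart_modelExp hdom hms).differentiableAt
    (by norm_num)).hasFDerivAt.comp_hasDerivAt t hP'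
  exact hd.deriv.trans hu

end Interpolation

end RiemannHermite

end

/-! ### The Hermite interpolation theorem -/

open RiemannHermite in
theorem theorem2p1
    {E : Type*} [NormedAddCommGroup E] [NormedSpace ℝ E] [FiniteDimensional ℝ E]
    {M : Type*} [TopologicalSpace M] [T2Space M] [ChartedSpace E M] [IsManifold 𝓘(ℝ, E) ∞ M]
    [RiemannianBundle (fun x : M ↦ TangentSpace 𝓘(ℝ, E) x)]
    [IsContMDiffRiemannianBundle 𝓘(ℝ, E) ∞ E (fun x : M ↦ TangentSpace 𝓘(ℝ, E) x)]
    (t₀ t₁ : ℝ) (ht : t₀ < t₁)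
    (f : ℝ → M) (hf : MDifferentiableOn 𝓘(ℝ, ℝ) 𝓘(ℝ, E) f (Icc t₀ t₁))
    (p q : M) (v_p : TangentSpace 𝓘(ℝ, E) p) (v_q : TangentSpace 𝓘(ℝ, E) q)
    -- `f t₀ = p`, `f' t₀ = v_p`, `f t₁ = q`, `f' t₁ = v_q`
    (hp : velocityWithin f (Icc t₀ t₁) t₀ = ⟨p, v_p⟩)
    (hq : velocityWithin f (Icc t₀ t₁) t₁ = ⟨q, v_q⟩)
    -- the open set on which `Exp_q` is inverted, and whose image contains `p`
    (D : Set (TangentSpace 𝓘(ℝ, E) q)) (hD : IsOpen D) (hDdom : D ⊆ expDomain q)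
    (hDinj : InjOn (expMap q) D) (hpD : p ∈ expMap q '' D)
    -- `p` and `q` are not conjugate along the connecting geodesic
    (hconj : ¬ AreConjugateAlong E (fun t : ℝ ↦ expMap q (t • logMap q D p)) 0 1) :
    MDifferentiableAt 𝓘(ℝ, E) 𝓘(ℝ, E) (M' := E) (logMap q D) p ∧
    -- the formula for the interpolating curve makes sense (automatic if `M` is complete)
    ((∀ t ∈ Icc t₀ t₁, tangentInterpolant t₀ t₁ p q D v_p v_q t ∈ expDomain q) →
      ContMDiffOn 𝓘(ℝ, ℝ) 𝓘(ℝ, E) 1 (hermiteCurve t₀ t₁ p q D v_p v_q) (Icc t₀ t₁) ∧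
      hermiteCurve t₀ t₁ p q D v_p v_q t₀ = p ∧
      hermiteCurve t₀ t₁ p q D v_p v_q t₁ = q ∧
      velocityWithin (hermiteCurve t₀ t₁ p q D v_p v_q) (Icc t₀ t₁) t₀ = ⟨p, v_p⟩ ∧
      velocityWithin (hermiteCurve t₀ t₁ p q D v_p v_q) (Icc t₀ t₁) t₁ = ⟨q, v_q⟩) := by
  obtain ⟨hlog, L, hL, hLu⟩ :=
    mdifferentiableAt_modelLog (E := E) (p := p) (q := q) (D := D) hD hDdom hDinj hpD hconj
  refine ⟨hlog, fun hdom ↦ ?_⟩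
  have ht₀ : t₀ ∈ Icc t₀ t₁ := ⟨le_rfl, ht.le⟩
  have ht₁ : t₁ ∈ Icc t₀ t₁ := ⟨ht.le, le_rfl⟩
  obtain ⟨P, hPdef⟩ : ∃ P : ℝ → E,
      P = hermiteInterpolant (E := E) t₀ t₁ (modelLog (E := E) q D p) (L v_p) v_q := ⟨_, rfl⟩
  have hcurve : hermiteCurve t₀ t₁ p q D v_p v_q = fun t ↦ modelExp q (P t) := by
    rw [hPdef, ← hL]
    rfl
  have hdomP : ∀ t ∈ Icc t₀ t₁, P t ∈ modelExpDomain (E := E) q := by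
    rw [hPdef, ← hL]
    exact hdom
  have hP : ContDiff ℝ 1 P := hPdef ▸ contDiff_hermiteInterpolant _ _ _ _ _
  have hP₀ : P t₀ = modelLog (E := E) q D p := hPdef ▸ hermiteInterpolant_left _ _ _ _ _
  have hP₁ : P t₁ = 0 := hPdef ▸ hermiteInterpolant_right ht _ _ _
  have hexp₀ : modelExp q (P t₀) = p := hP₀ ▸ Function.invFunOn_eq hpD
  have hexp₁ : modelExp q (P t₁) = q := hP₁ ▸ modelExp_zero q
  rw [hcurve]
  refine ⟨fun t htI ↦ (contMDiffAt_modelExp_comp hP (hdomP t htI)).contMDiffWithinAt, hexp₀, hexp₁,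
    ?_, ?_⟩
  · refine velocityWithin_modelExp_comp (E := E) (uniqueDiffOn_Icc ht t₀ ht₀) hP (hdomP t₀ ht₀)
      (hPdef ▸ hasDerivAt_hermiteInterpolant_left _ _ _) hexp₀ ?_
    -- At Δ_p the differential of `Exp_q` undoes L = d(Log_q)_p.
    rw [hP₀]
    exact hLu v_p
  · refine velocityWithin_modelExp_comp (E := E) (uniqueDiffOn_Icc ht t₁ ht₁) hP (hdomP t₁ ht₁)
      (hPdef ▸ hasDerivAt_hermiteInterpolant_right ht _ _ _) hexp₁ ?_
    -- At the origin of T_q M the differential of `Exp_q` is the identity, so v_q needs no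
    -- correction.
    rw [hP₁]
    exact fderiv_chart_modelExp_zero (E := E) q v_q
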